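/- Let $(K^7,\eta,\xi,J,\Omega)$ be a contact Calabi--Yau $7$-manifold: a Sasakian manifold with transverse Kähler form $\omega=d\eta$, transverse complex structure $J$ and transverse metric $g_V=\omega(\cdot,J\cdot)$, and a closed horizontal complex volume form $\Omega$ of type $(3,0)$ with $\frac{\omega^3}{3!}=\frac14\operatorname{Re}\Omega\wedge\operatorname{Im}\Omega$; locally $K$ fibres over the Calabi--Yau space $V$ of Reeb orbits. For $\epsilon>0$ let $g_\epsilon=\epsilon^2\eta\otimes\eta+g_V$ and $H_\epsilon=-\epsilon^2\eta\wedge\omega+\epsilon\operatorname{Re}\Omega$. Consider local coframes $(e_0,e,Je)$ of $K$, where $e_0=\epsilon\eta$, $e=(e_1,e_2,e_3)^{\rm T}$, $Je=(Je_1,Je_2,Je_3)^{\rm T}$, and the $e_i,Je_i$ are basic $1$-forms (pulled back from $V$) with $\omega=\sum_i e_i\wedge Je_i$ and $\Omega=(e_1+iJe_1)\wedge(e_2+iJe_2)\wedge(e_3+iJe_3)$; here $J\alpha=-\alpha\circ J$ on $1$-forms. Let $A$ be the pullback to $\ker\eta=\pi^*TV$ of the Levi-Civita connection of $g_V$, extended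 to $TK=\mathbb R\xi\oplus\ker\eta$ by making $\xi$ parallel, and let $F_A$ be its curvature. For a vector $a$ with three entries and vectors $a,b$ of $1$-forms put $$[a]=\begin{pmatrix}0&a_3&-a_2\\-a_3&0&a_1\\a_2&-a_1&0\end{pmatrix},\qquad a\times b=\begin{pmatrix}a_2\wedge b_3-a_3\wedge b_2\\a_3\wedge b_1-a_1\wedge b_3\\a_1\wedge b_2-a_2\wedge b_1\end{pmatrix},$$ and define $$B=\begin{pmatrix}0&Je^{\rm T}&-e^{\rm T}\\-Je&0&-e_0I\\e&e_0I&0\end{pmatrix},\quad C=\begin{pmatrix}0&Je^{\rm T}&-e^{\rm T}\\-Je&-[e]&e_0I+[Je]\\e&-e_0I+[Je]&[e]\end{pmatrix},\quad \mathcal I=\begin{pmatrix}0&0&0\\0&0&-I\\0&I&0\end{pmatrix},$$ $$Q^\delta_-=e_0\wedge\begin{pmatrix}0&(1+\delta)e^{\rm T}&(1+\delta)Je^{\rm T}\\-(1+\delta)e&-2\delta[Je]&-2\delta[e]\\-(1+\delta)Je&-2\delta[e]&2\delta[Je]\end{pmatrix},$$ $$Q^\delta_+=\begin{pmatrix}0&2\delta(e\times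 Je)^{\rm T}&\delta(e\times e-Je\times Je)^{\rm T}\\-2\delta(e\times Je)&-(1+\delta)Je\wedge Je^{\rm T}&(1+\delta)Je\wedge e^{\rm T}\\-\delta(e\times e-Je\times Je)&(1+\delta)e\wedge Je^{\rm T}&-(1+\delta)e\wedge e^{\rm T}\end{pmatrix},$$ $$Q_0=\frac12\begin{pmatrix}0&0&0\\0&-[e\times e+Je\times Je]&-2([e]\wedge[Je]-[Je]\wedge[e])\\0&2([e]\wedge[Je]-[Je]\wedge[e])&-[e\times e+Je\times Je]\end{pmatrix}.$$ Let $\epsilon>0$, $k\in\mathbb R\setminus\{0\}$ and $\delta,m\in\mathbb R$. Then there is a connection $\theta^{\delta,k}_{\epsilon,m}$ on $TK$ whose matrix in every local coframe as above is $$\theta^{\delta,k}_{\epsilon,m}=\theta^{\delta,k}_\epsilon+\frac{km\epsilon}{2}e_0\mathcal I,\qquad \theta^{\delta,k}_\epsilon=A+\frac{k\epsilon}{2}B+\frac{k\epsilon\delta}{2}C.$$ On the domain of every such coframe, every connection with these matrices has torsion $$H^{\delta,k}_{\epsilon,m}=\Big(1-k-\frac{km}{2}\Big)\epsilon\,\omega\otimes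 e_0+\frac{km\epsilon}{2}\,e_0\wedge\omega+k\delta H_\epsilon$$ (where an index is raised with $g_\epsilon$ to view the right-hand side as a vector-valued $2$-form), and its curvature matrix in the coframe is $$R^{\delta,k}_{\epsilon,m}=F_A+\frac{k\epsilon^2(1-\delta+m)}{2}\,\omega\,\mathcal I+\frac{k^2\epsilon^2}{4}Q^\delta_m,\qquad Q^\delta_m=(1-\delta+m)Q^\delta_-+(1+\delta)Q^\delta_++\delta^2Q_0 .$$ -/

import Mathlib

open scoped Manifold ContDiff Topology

noncomputable section

/-- The model space of a `7`-manifold. -/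
abbrev E7 : Type := EuclideanSpace ℝ (Fin 7)

/-! ### Matrices of covectors

`V` is a real topological vector space (a tangent space of the manifold). `1`-forms at a point are
elements of `V →L[ℝ] ℝ`, and `2`-forms are bilinear maps `V →L[ℝ] V →L[ℝ] ℝ`. -/

section Pointwise

variable {V : Type*} [AddCommGroup V] [Module ℝ V] [TopologicalSpace V]
  [IsTopologicalAddGroup V] [ContinuousSMul ℝ V]

/-- The wedge product of two covectors, `(α ∧ β)(X, Y) = α(X) β(Y) - β(X) α(Y)`. -/
def wedge₁₁ (α β : V →L[ℝ] ℝ) : V →L[ℝ] V →L[ℝ] ℝ :=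
  α.smulRight β - β.smulRight α

/-- The wedge product of matrices of `1`-forms: the matrix product whose scalar product is `∧`. -/
def matWedge {l m n : Type*} [Fintype m] (M : Matrix l m (V →L[ℝ] ℝ))
    (N : Matrix m n (V →L[ℝ] ℝ)) : Matrix l n (V →L[ℝ] V →L[ℝ] ℝ) :=
  fun i j => ∑ c, wedge₁₁ (M i c) (N c j)

/-- The column-times-row product `a ∧ bᵀ` of two vectors of `1`-forms. -/
def colWedgeRow (a b : Fin 3 → (V →L[ℝ] ℝ)) : Matrix (Fin 3) (Fin 3) (V →L[ℝ] V →L[ℝ] ℝ) :=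
  fun i j => wedge₁₁ (a i) (b j)

/-- The vector product `a × b` of two vectors of `1`-forms. -/
def crossWedge (a b : Fin 3 → (V →L[ℝ] ℝ)) : Fin 3 → (V →L[ℝ] V →L[ℝ] ℝ) :=
  ![wedge₁₁ (a 1) (b 2) - wedge₁₁ (a 2) (b 1),
    wedge₁₁ (a 2) (b 0) - wedge₁₁ (a 0) (b 2),
    wedge₁₁ (a 0) (b 1) - wedge₁₁ (a 1) (b 0)]

/-- The skew-symmetric matrix `[a]` of a vector `a` (of `1`-forms or of `2`-forms). -/
def box {R : Type*} [AddCommGroup R] (a : Fin 3 → R) : Matrix (Fin 3) (Fin 3) R :=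
  !![0, a 2, -a 1; -a 2, 0, a 0; a 1, -a 0, 0]

/-- The index set of the coframe `(e₀, e₁, e₂, e₃, Je₁, Je₂, Je₃)`. -/
abbrev Idx : Type := Unit ⊕ (Fin 3 ⊕ Fin 3)

/-- The `7 × 7` matrix with `(1, 3, 3)`-blocks
`(0, r₁ᵀ, r₂ᵀ ; c₁, a, b ; c₂, c, d)`. -/
def block {R : Type*} [Zero R] (r₁ r₂ c₁ c₂ : Fin 3 → R) (a b c d : Matrix (Fin 3) (Fin 3) R) :
    Matrix Idx Idx R :=
  fun p q => match p, q with
    | .inl _, .inl _ => 0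
    | .inl _, .inr (.inl j) => r₁ j
    | .inl _, .inr (.inr j) => r₂ j
    | .inr (.inl i), .inl _ => c₁ i
    | .inr (.inr i), .inl _ => c₂ i
    | .inr (.inl i), .inr (.inl j) => a i j
    | .inr (.inl i), .inr (.inr j) => b i j
    | .inr (.inr i), .inr (.inl j) => c i j
    | .inr (.inr i), .inr (.inr j) => d i j

/-- The constant matrix `𝓘 = (0, 0, 0 ; 0, 0, -I ; 0, I, 0)`. -/
def matI : Matrix Idx Idx ℝ := block 0 0 0 0 0 (-1) 1 0

/-- `α M`, for a `1`-form `α` and a constant matrix `M`. -/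
def formSmul (α : V →L[ℝ] ℝ) (M : Matrix Idx Idx ℝ) : Matrix Idx Idx (V →L[ℝ] ℝ) :=
  fun p q => M p q • α

/-- `α I`, the `3 × 3` scalar matrix with the `1`-form `α` on the diagonal. -/
def scalarForm (α : V →L[ℝ] ℝ) : Matrix (Fin 3) (Fin 3) (V →L[ℝ] ℝ) :=
  Matrix.diagonal fun _ => α

/-- `B = (0, Jeᵀ, -eᵀ ; -Je, 0, -e₀I ; e, e₀I, 0)`. -/
def matB (e₀ : V →L[ℝ] ℝ) (e Je : Fin 3 → (V →L[ℝ] ℝ)) : Matrix Idx Idx (V →L[ℝ] ℝ) :=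
  block Je (-e) (-Je) e 0 (-scalarForm e₀) (scalarForm e₀) 0

/-- `C = (0, Jeᵀ, -eᵀ ; -Je, -[e], e₀I + [Je] ; e, -e₀I + [Je], [e])`. -/
def matC (e₀ : V →L[ℝ] ℝ) (e Je : Fin 3 → (V →L[ℝ] ℝ)) : Matrix Idx Idx (V →L[ℝ] ℝ) :=
  block Je (-e) (-Je) e (-box e) (scalarForm e₀ + box Je) (-scalarForm e₀ + box Je) (box e)

/-- `Q₋^δ`, the wedge product of `e₀` with a matrix of `1`-forms. -/
def matQminus (δ : ℝ) (e₀ : V →L[ℝ] ℝ) (e Je : Fin 3 → (V →L[ℝ] ℝ)) :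
    Matrix Idx Idx (V →L[ℝ] V →L[ℝ] ℝ) :=
  (block ((1 + δ) • e) ((1 + δ) • Je) (-((1 + δ) • e)) (-((1 + δ) • Je))
    ((-2 * δ) • box Je) ((-2 * δ) • box e) ((-2 * δ) • box e) ((2 * δ) • box Je)).map (wedge₁₁ e₀)

/-- `Q₊^δ`. -/
def matQplus (δ : ℝ) (e Je : Fin 3 → (V →L[ℝ] ℝ)) : Matrix Idx Idx (V →L[ℝ] V →L[ℝ] ℝ) :=
  block ((2 * δ) • crossWedge e Je) (δ • (crossWedge e e - crossWedge Je Je))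
    (-((2 * δ) • crossWedge e Je)) (-(δ • (crossWedge e e - crossWedge Je Je)))
    (-((1 + δ) • colWedgeRow Je Je)) ((1 + δ) • colWedgeRow Je e)
    ((1 + δ) • colWedgeRow e Je) (-((1 + δ) • colWedgeRow e e))

/-- `Q₀`. -/
def matQzero (e Je : Fin 3 → (V →L[ℝ] ℝ)) : Matrix Idx Idx (V →L[ℝ] V →L[ℝ] ℝ) :=
  (1 / 2 : ℝ) • block 0 0 0 0
    (-box (crossWedge e e + crossWedge Je Je))
    ((-2 : ℝ) • (matWedge (box e) (box Je) - matWedge (box Je) (box e)))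
    ((2 : ℝ) • (matWedge (box e) (box Je) - matWedge (box Je) (box e)))
    (-box (crossWedge e e + crossWedge Je Je))

/-- `Q_m^δ = (1 - δ + m) Q₋^δ + (1 + δ) Q₊^δ + δ² Q₀`. -/
def matQ (δ m : ℝ) (e₀ : V →L[ℝ] ℝ) (e Je : Fin 3 → (V →L[ℝ] ℝ)) :
    Matrix Idx Idx (V →L[ℝ] V →L[ℝ] ℝ) :=
  (1 - δ + m) • matQminus δ e₀ e Je + (1 + δ) • matQplus δ e Je + δ ^ 2 • matQzero e Je

end Pointwise

/-- The wedge product of alternating forms (sum over shuffles). -/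
def altWedge {V : Type*} [AddCommGroup V] [Module ℝ V] {p q : ℕ}
    (α : V [⋀^Fin p]→ₗ[ℝ] ℝ) (β : V [⋀^Fin q]→ₗ[ℝ] ℝ) : V [⋀^Fin (p + q)]→ₗ[ℝ] ℝ :=
  ((LinearMap.mul' ℝ ℝ).compAlternatingMap (α.domCoprod β)).domDomCongr finSumFinEquiv

/-! ### Differential forms and connections on a `7`-manifold -/

section Manifold

variable {K : Type*} [TopologicalSpace K] [ChartedSpace E7 K]

/-- The local representative on `ℝ⁷` of a differential form `α`, in the chart at `x₀`. -/
def chartForm {n : ℕ} {F : Type*} [NormedAddCommGroup F] [NormedSpace ℝ F]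
    (α : ∀ x : K, TangentSpace (𝓡 7) x [⋀^Fin n]→L[ℝ] F) (x₀ : K) (y : E7) :
    E7 [⋀^Fin n]→L[ℝ] F :=
  (α ((extChartAt (𝓡 7) x₀).symm y)).compContinuousLinearMap
    (mfderiv 𝓘(ℝ, E7) (𝓡 7) (extChartAt (𝓡 7) x₀).symm y)

/-- Smoothness of a differential form on a set, read in charts. -/
def SmoothFormOn {n : ℕ} {F : Type*} [NormedAddCommGroup F] [NormedSpace ℝ F]
    (α : ∀ x : K, TangentSpace (𝓡 7) x [⋀^Fin n]→L[ℝ] F) (U : Set K) : Prop :=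
  ∀ x₀ : K, ContDiffOn ℝ ∞ (chartForm α x₀)
    ((extChartAt (𝓡 7) x₀).target ∩ (extChartAt (𝓡 7) x₀).symm ⁻¹' U)

/-- The exterior derivative of a differential form, computed at `x` in the chart at `x`. -/
def mextDeriv {n : ℕ} {F : Type*} [NormedAddCommGroup F] [NormedSpace ℝ F]
    (α : ∀ x : K, TangentSpace (𝓡 7) x [⋀^Fin n]→L[ℝ] F) (x : K) :
    TangentSpace (𝓡 7) x [⋀^Fin (n + 1)]→L[ℝ] F :=
  (extDeriv (chartForm α x) (extChartAt (𝓡 7) x x)).compContinuousLinearMap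
    (mfderiv (𝓡 7) 𝓘(ℝ, E7) (extChartAt (𝓡 7) x) x)

/-- A field of covectors as an alternating `1`-form. -/
def oneForm (α : ∀ x : K, TangentSpace (𝓡 7) x →L[ℝ] ℝ) (x : K) :
    TangentSpace (𝓡 7) x [⋀^Fin 1]→L[ℝ] ℝ :=
  ContinuousAlternatingMap.ofSubsingleton ℝ (TangentSpace (𝓡 7) x) ℝ (0 : Fin 1) (α x)

variable [IsManifold (𝓡 7) ∞ K]

/-- The vector field `X` is smooth at `x`. -/
def SmoothFieldAt (X : ∀ x : K, TangentSpace (𝓡 7) x) (x : K) : Prop :=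
  ContMDiffAt (𝓡 7) (𝓡 7).tangent ∞ (fun y => (⟨y, X y⟩ : TangentBundle (𝓡 7) K)) x

/-- The vector field `X` is differentiable at `x`. -/
def DiffFieldAt (X : ∀ x : K, TangentSpace (𝓡 7) x) (x : K) : Prop :=
  MDifferentiableAt (𝓡 7) (𝓡 7).tangent (fun y => (⟨y, X y⟩ : TangentBundle (𝓡 7) K)) x

/-- Connections on `TK`. -/
abbrev TangentConnection (K : Type*) [TopologicalSpace K] [ChartedSpace E7 K]
    [IsManifold (𝓡 7) ∞ K] : Type _ :=
  CovariantDerivative (𝓡 7) E7 (TangentSpace (𝓡 7) : K → Type _)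

/-- The curvature `R(X, Y) Z = ∇_X ∇_Y Z - ∇_Y ∇_X Z - ∇_{[X, Y]} Z` of a connection on `TK`
(`D Z x v` is `∇_v Z` at `x`). -/
def curvatureOp (D : TangentConnection K) (X Y Z : ∀ x : K, TangentSpace (𝓡 7) x) (x : K) :
    TangentSpace (𝓡 7) x :=
  D (fun y => D Z y (Y y)) x (X x) - D (fun y => D Z y (X y)) x (Y x)
    - D Z x (VectorField.mlieBracket (𝓡 7) X Y x)

/-- The real part of a complex-valued alternating form. -/
def reForm {x : K} (Ω : TangentSpace (𝓡 7) x [⋀^Fin 3]→L[ℝ] ℂ) :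
    TangentSpace (𝓡 7) x [⋀^Fin 3]→ₗ[ℝ] ℝ :=
  Complex.reLm.compAlternatingMap Ω.toAlternatingMap

/-- The imaginary part of a complex-valued alternating form. -/
def imForm {x : K} (Ω : TangentSpace (𝓡 7) x [⋀^Fin 3]→L[ℝ] ℂ) :
    TangentSpace (𝓡 7) x [⋀^Fin 3]→ₗ[ℝ] ℝ :=
  Complex.imLm.compAlternatingMap Ω.toAlternatingMap

variable (K) in
/-- A contact Calabi-Yau structure `(η, ξ, J, Ω)` on a `7`-manifold: a Sasakian structure with
transverse Kähler form `ω = dη` and transverse metric `ω(·, J·)`, together with a closed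
horizontal complex volume form `Ω` of type `(3, 0)`. The transverse complex structure `J` is
extended to `TK` by `Jξ = 0`. -/
structure ContactCalabiYau where
  /-- the contact form -/
  η : ∀ x : K, TangentSpace (𝓡 7) x →L[ℝ] ℝ
  /-- the Reeb field -/
  ξ : ∀ x : K, TangentSpace (𝓡 7) x
  /-- the transverse complex structure -/
  J : ∀ x : K, TangentSpace (𝓡 7) x →L[ℝ] TangentSpace (𝓡 7) x
  /-- the transverse holomorphic volume form -/
  Ω : ∀ x : K, TangentSpace (𝓡 7) x [⋀^Fin 3]→L[ℝ] ℂ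
  smooth_η : SmoothFormOn (oneForm η) Set.univ
  smooth_ξ : ∀ x, SmoothFieldAt ξ x
  smooth_J : ∀ X x, SmoothFieldAt X x → SmoothFieldAt (fun y => J y (X y)) x
  smooth_Ω : SmoothFormOn Ω Set.univ
  η_ξ : ∀ x, η x (ξ x) = 1
  reeb : ∀ x v, mextDeriv (oneForm η) x ![ξ x, v] = 0
  J_sq : ∀ x v, J x (J x v) = -v + η x v • ξ x
  J_invariant : ∀ x v w,
    mextDeriv (oneForm η) x ![J x v, J x w] = mextDeriv (oneForm η) x ![v, w]
  positive : ∀ x v, η x v = 0 → v ≠ 0 → 0 < mextDeriv (oneForm η) x ![v, J x v]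
  /-- normality of the almost contact structure: `[J, J] + dη ⊗ ξ = 0` -/
  normal : ∀ X Y x, SmoothFieldAt X x → SmoothFieldAt Y x →
    J x (J x (VectorField.mlieBracket (𝓡 7) X Y x))
      + VectorField.mlieBracket (𝓡 7) (fun y => J y (X y)) (fun y => J y (Y y)) x
      - J x (VectorField.mlieBracket (𝓡 7) (fun y => J y (X y)) Y x)
      - J x (VectorField.mlieBracket (𝓡 7) X (fun y => J y (Y y)) x)
      + mextDeriv (oneForm η) x ![X x, Y x] • ξ x = 0
  Ω_horizontal : ∀ x v w, Ω x ![ξ x, v, w] = 0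
  Ω_type : ∀ x u v w, Ω x ![J x u, v, w] = Complex.I * Ω x ![u, v, w]
  /-- the normalization `ω³ / 3! = Re Ω ∧ Im Ω / 4` -/
  volume_eq : ∀ x,
    (1 / 6 : ℝ) • altWedge (altWedge (mextDeriv (oneForm η) x).toAlternatingMap
        (mextDeriv (oneForm η) x).toAlternatingMap) (mextDeriv (oneForm η) x).toAlternatingMap
      = (1 / 4 : ℝ) • altWedge (reForm (Ω x)) (imForm (Ω x))
  Ω_closed : ∀ x, mextDeriv Ω x = 0

namespace ContactCalabiYau

variable (S : ContactCalabiYau K)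

/-- The transverse Kähler form `ω = dη`. -/
def kaehler (x : K) (v w : TangentSpace (𝓡 7) x) : ℝ := mextDeriv (oneForm S.η) x ![v, w]

/-- The transverse Calabi-Yau metric, `g_V(v, w) = ω(v, Jw)`. -/
def gV (x : K) (v w : TangentSpace (𝓡 7) x) : ℝ := S.kaehler x v (S.J x w)

/-- The metric `g_ε = ε² η ⊗ η + g_V`. -/
def g (ε : ℝ) (x : K) (v w : TangentSpace (𝓡 7) x) : ℝ :=
  ε ^ 2 * (S.η x v * S.η x w) + S.gV x v w

/-- The `3`-form `α ∧ ω`, for a `1`-form `α`. -/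
def wedgeKaehler (x : K) (α : TangentSpace (𝓡 7) x →L[ℝ] ℝ) (u v w : TangentSpace (𝓡 7) x) : ℝ :=
  α u * S.kaehler x v w + α v * S.kaehler x w u + α w * S.kaehler x u v

/-- The flux `H_ε = -ε² η ∧ ω + ε Re Ω`. -/
def flux (ε : ℝ) (x : K) (u v w : TangentSpace (𝓡 7) x) : ℝ :=
  -ε ^ 2 * S.wedgeKaehler x (S.η x) u v w + ε * (S.Ω x ![u, v, w]).re

/-- `D` is the connection `A` on `TK = ℝξ ⊕ ker η` that is trivial on `ξ` and is, on
`ker η = π^*TV`, the transverse Levi-Civita connection, that is the pullback of the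
Levi-Civita connection of `g_V` on the (local) space `V` of Reeb orbits. -/
structure IsTransverseLeviCivita (D : TangentConnection K) : Prop where
  parallel_ξ : ∀ x, D S.ξ x = 0
  /-- `ker η` is preserved. -/
  horizontal : ∀ Y x, DiffFieldAt Y x → (∀ᶠ y in 𝓝 x, S.η y (Y y) = 0) →
    ∀ v, S.η x (D Y x v) = 0
  /-- The connection is metric. -/
  metric : ∀ Y Z x, DiffFieldAt Y x → DiffFieldAt Z x →
    (∀ᶠ y in 𝓝 x, S.η y (Y y) = 0) → (∀ᶠ y in 𝓝 x, S.η y (Z y) = 0) →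
    ∀ v : TangentSpace (𝓡 7) x,
      (mfderiv (𝓡 7) 𝓘(ℝ, ℝ) (fun y => S.gV y (Y y) (Z y)) x v : ℝ)
        = S.gV x (D Y x v) (Z x) + S.gV x (Y x) (D Z x v)
  /-- The connection has no horizontal torsion: `∇_X Y - ∇_Y X` is the horizontal part of
  `[X, Y]`. -/
  torsion_free : ∀ X Y x, DiffFieldAt X x → DiffFieldAt Y x →
    (∀ᶠ y in 𝓝 x, S.η y (X y) = 0) → (∀ᶠ y in 𝓝 x, S.η y (Y y) = 0) →
    D Y x (X x) - D X x (Y x) = VectorField.mlieBracket (𝓡 7) X Y x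
      - S.η x (VectorField.mlieBracket (𝓡 7) X Y x) • S.ξ x
  /-- Along the Reeb orbits, `∇_ξ Y` is the horizontal part of `[ξ, Y]`, so that sections
  pulled back from `V` are parallel. -/
  vertical : ∀ Y x, DiffFieldAt Y x → (∀ᶠ y in 𝓝 x, S.η y (Y y) = 0) →
    D Y x (S.ξ x) = VectorField.mlieBracket (𝓡 7) S.ξ Y x
      - S.η x (VectorField.mlieBracket (𝓡 7) S.ξ Y x) • S.ξ x

/-- A basic local `SU(3)`-coframe `(e₁, e₂, e₃, Je₁, Je₂, Je₃)` on an open set `U`, together with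
the vector fields `u₁, u₂, u₃` of the dual frame `(u₁, u₂, u₃, Ju₁, Ju₂, Ju₃)` of `ker η`.
Here `J` acts on `1`-forms by `Jα = -α ∘ J`, so that `e_i + i Je_i` is of type `(1, 0)`.
The coframe is basic: it is annihilated by `ξ`, and so are the differentials `de_i`, `d(Je_i)`. -/
structure Coframe where
  U : Set K
  isOpen_U : IsOpen U
  e : Fin 3 → ∀ x : K, TangentSpace (𝓡 7) x →L[ℝ] ℝ
  Je : Fin 3 → ∀ x : K, TangentSpace (𝓡 7) x →L[ℝ] ℝ
  u : Fin 3 → ∀ x : K, TangentSpace (𝓡 7) x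
  smooth_e : ∀ i, SmoothFormOn (oneForm (e i)) U
  smooth_Je : ∀ i, SmoothFormOn (oneForm (Je i)) U
  smooth_u : ∀ i, ∀ x ∈ U, SmoothFieldAt (u i) x
  Je_eq : ∀ i, ∀ x ∈ U, ∀ v, Je i x v = -e i x (S.J x v)
  e_ξ : ∀ i, ∀ x ∈ U, e i x (S.ξ x) = 0
  basic_e : ∀ i, ∀ x ∈ U, ∀ v, mextDeriv (oneForm (e i)) x ![S.ξ x, v] = 0
  basic_Je : ∀ i, ∀ x ∈ U, ∀ v, mextDeriv (oneForm (Je i)) x ![S.ξ x, v] = 0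
  η_u : ∀ i, ∀ x ∈ U, S.η x (u i x) = 0
  e_u : ∀ i j, ∀ x ∈ U, e i x (u j x) = if i = j then 1 else 0
  Je_u : ∀ i j, ∀ x ∈ U, Je i x (u j x) = 0
  /-- `ω = e₁ ∧ Je₁ + e₂ ∧ Je₂ + e₃ ∧ Je₃` -/
  ω_eq : ∀ x ∈ U, ∀ v w, S.kaehler x v w = ∑ i, wedge₁₁ (e i x) (Je i x) v w
  /-- `Ω = (e₁ + i Je₁) ∧ (e₂ + i Je₂) ∧ (e₃ + i Je₃)` -/
  Ω_eq : ∀ x ∈ U, ∀ v : Fin 3 → TangentSpace (𝓡 7) x,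
    S.Ω x v = Matrix.det (Matrix.of fun i j : Fin 3 =>
      ((e i x (v j) : ℂ) + Complex.I * (Je i x (v j) : ℂ)))

namespace Coframe

variable {S} (c : S.Coframe)

/-- The `g_ε`-orthonormal coframe `(e₀, e, Je)`, with `e₀ = ε η`. -/
def coframe (ε : ℝ) : Idx → ∀ x : K, TangentSpace (𝓡 7) x →L[ℝ] ℝ
  | .inl _ => fun x => ε • S.η x
  | .inr (.inl i) => c.e i
  | .inr (.inr i) => c.Je i

/-- The dual frame `(ε⁻¹ ξ, u, Ju)`. -/
def frame (ε : ℝ) : Idx → ∀ x : K, TangentSpace (𝓡 7) x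
  | .inl _ => fun x => ε⁻¹ • S.ξ x
  | .inr (.inl i) => c.u i
  | .inr (.inr i) => fun x => S.J x (c.u i x)

/-- The local matrix of `1`-forms of a connection `D`: `D E_b = ∑_a θ_{ab} ⊗ E_a`. -/
def connMatrix (ε : ℝ) (D : TangentConnection K) (x : K) :
    Matrix Idx Idx (TangentSpace (𝓡 7) x →L[ℝ] ℝ) :=
  fun a b => (c.coframe ε a x).comp (D (c.frame ε b) x)

/-- The local curvature matrix of a connection `D`, evaluated on the vector fields `X`, `Y`:
`R(X, Y) E_b = ∑_a R_{ab}(X, Y) E_a`. -/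
def curvMatrix (ε : ℝ) (D : TangentConnection K) (X Y : ∀ x : K, TangentSpace (𝓡 7) x) (x : K) :
    Matrix Idx Idx ℝ :=
  fun a b => c.coframe ε a x (curvatureOp D X Y (c.frame ε b) x)

/-- The local matrix `θ_ε^{δ,k} = A + (kε/2) B + (kεδ/2) C`, where `A` is the local matrix of the
transverse Levi-Civita connection. -/
def squashedMatrix (ε δ k : ℝ) (A : TangentConnection K) (x : K) :
    Matrix Idx Idx (TangentSpace (𝓡 7) x →L[ℝ] ℝ) :=
  c.connMatrix ε A x
    + (k * ε / 2) • matB (ε • S.η x) (fun i => c.e i x) (fun i => c.Je i x)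
    + (k * ε * δ / 2) • matC (ε • S.η x) (fun i => c.e i x) (fun i => c.Je i x)

/-- The local matrix `θ_{ε,m}^{δ,k} = θ_ε^{δ,k} + (kmε/2) e₀ 𝓘`. -/
def twistedMatrix (ε δ k m : ℝ) (A : TangentConnection K) (x : K) :
    Matrix Idx Idx (TangentSpace (𝓡 7) x →L[ℝ] ℝ) :=
  c.squashedMatrix ε δ k A x + (k * m * ε / 2) • formSmul (ε • S.η x) matI

end Coframe

/-- `D` is the twisted connection `θ_{ε,m}^{δ,k}`: in every basic local `SU(3)`-coframe its
matrix is `twistedMatrix`. -/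
def IsTwistedConnection (ε δ k m : ℝ) (A D : TangentConnection K) : Prop :=
  ∀ c : S.Coframe, ∀ x ∈ c.U, c.connMatrix ε D x = c.twistedMatrix ε δ k m A x

end ContactCalabiYau

end Manifold

end

/-!
The twisted connection is `θ = A + a`, where `A` is the transverse Levi-Civita connection and the
endomorphism-valued `1`-form `a` has, in every basic coframe, the matrix `(kε/2) N` with
`N = B + δ C + m e₀ 𝓘`. Everything rests on four algebraic properties of `N`, a matrix that depends
linearly on a vector of `ℝ⁷` (`bismutMatrix`).

* Lowering its indices with `g_ε` gives a trilinear form in `η`, `ω` and `Re Ω` alone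
  (`sum_bismutMatrix`); the part of `C` is the `3`-form `-e₀ ∧ ω + Re Ω`. Hence `a` does not depend
  on the coframe (`Coframe.twistTensor_eq`) and `θ` exists. The torsion of `A` is `ω ⊗ ξ`
  (`Coframe.torsion_transverseLeviCivita`), and antisymmetrizing `a` gives the torsion of `θ`
  (`Coframe.g_torsion`).
* It is invariant under `𝔰𝔲(3)`: `[Γ, N(w)] = N(Γ w)` (`commutator_bismutMatrix`).
* Its value on the Reeb field is a multiple of `𝓘` (`bismutMatrix_inl`).
* Its commutator `[N(X), N(Y)]` is `Q_m^δ(X, Y)` (`bismutMatrix_commutator`).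

In `dθ + θ ∧ θ` the terms of second order in `a` are thus `(k²ε²/4) Q_m^δ`. The terms of first order
are the covariant exterior derivative of `a`. As the holonomy of `A` is in `SU(3)`, invariance
shows that this is `N` applied to the torsion `ω ⊗ ξ` of `A`, which is a multiple of `ω 𝓘`
(`Coframe.curvMatrix_of_isTwistedConnection`).

That the connection matrix `Γ` of `A` is in `𝔰𝔲(3)` has to be derived from the axioms of a contact
Calabi-Yau structure. It commutes with `J` because `dω = 0` and `J` is transversally integrable, the
classical argument for Kähler manifolds (`unitary_of_kaehler_of_integrable`), and its complex trace
vanishes because `dΩ = 0` (`Coframe.sum_connMatrix_frame`). The exterior derivative is defined in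
charts, so these facts are read off from the formula for `dα` in terms of Lie brackets
(`mextDeriv_apply_vectorField`), applied to the frame dual to the coframe.
-/

noncomputable section

/-! ### Exterior derivative and Lie brackets -/

section Calculus

variable {K : Type*} [TopologicalSpace K] [ChartedSpace E7 K]

/-- The representative on `ℝ⁷` of the vector field `X`, in the chart at `x₀`. -/
def chartField (X : ∀ x : K, TangentSpace (𝓡 7) x) (x₀ : K) : E7 → E7 :=
  VectorField.mpullbackWithin 𝓘(ℝ, E7) (𝓡 7) (extChartAt (𝓡 7) x₀).symm X (Set.range (𝓡 7))

lemma SmoothFormOn.differentiableAt_chartForm {n : ℕ} {F : Type*} [NormedAddCommGroup F]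
    [NormedSpace ℝ F] {α : ∀ x : K, TangentSpace (𝓡 7) x [⋀^Fin n]→L[ℝ] F} {U : Set K}
    (hα : SmoothFormOn α U) (hU : IsOpen U) {x : K} (hx : x ∈ U) :
    DifferentiableAt ℝ (chartForm α x) (extChartAt (𝓡 7) x x) := by
  have hn : (extChartAt (𝓡 7) x).target ∩ (extChartAt (𝓡 7) x).symm ⁻¹' U
      ∈ 𝓝 (extChartAt (𝓡 7) x x) := by
    refine Filter.inter_mem (extChartAt_target_mem_nhds x) ?_
    exact (continuousAt_extChartAt_symm x).preimage_mem_nhds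
      (by rw [extChartAt_to_inv]; exact hU.mem_nhds hx)
  exact ((hα x).contDiffAt hn).differentiableAt (by simp)

/-- A function on the manifold is differentiable when its chart representative is, and its
derivative is read in the chart. -/
lemma hasMFDerivAt_of_chart {F : Type*} [NormedAddCommGroup F] [NormedSpace ℝ F] {f : K → F}
    {x : K} {h : E7 → F} (hh : DifferentiableAt ℝ h (extChartAt (𝓡 7) x x))
    (hf : ∀ᶠ y in 𝓝 (extChartAt (𝓡 7) x x), h y = f ((extChartAt (𝓡 7) x).symm y)) :
    HasMFDerivAt (𝓡 7) 𝓘(ℝ, F) f x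
      (fderiv ℝ h (extChartAt (𝓡 7) x x) : E7 →L[ℝ] F) := by
  have h2 : DifferentiableAt ℝ (f ∘ (extChartAt (𝓡 7) x).symm) (extChartAt (𝓡 7) x x) :=
    hh.congr_of_eventuallyEq (hf.mono fun y hy => hy.symm)
  refine ⟨?_, ?_⟩
  · have hc : ContinuousAt ((f ∘ (extChartAt (𝓡 7) x).symm) ∘ extChartAt (𝓡 7) x) x :=
      h2.continuousAt.comp (continuousAt_extChartAt x)
    refine hc.congr ?_
    filter_upwards [extChartAt_source_mem_nhds (I := 𝓡 7) x] with y hy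
    exact congrArg f ((extChartAt (𝓡 7) x).left_inv hy)
  · have h3 : HasFDerivAt (f ∘ (extChartAt (𝓡 7) x).symm)
        (fderiv ℝ h (extChartAt (𝓡 7) x x)) (extChartAt (𝓡 7) x x) :=
      hh.hasFDerivAt.congr_of_eventuallyEq (hf.mono fun y hy => hy.symm)
    exact h3.hasFDerivWithinAt

variable [IsManifold (𝓡 7) ∞ K]

lemma chartForm_apply_chartField {n : ℕ} {F : Type*} [NormedAddCommGroup F] [NormedSpace ℝ F]
    (α : ∀ x : K, TangentSpace (𝓡 7) x [⋀^Fin n]→L[ℝ] F)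
    (X : Fin n → ∀ x : K, TangentSpace (𝓡 7) x) (x₀ : K) {y : E7}
    (hy : y ∈ (extChartAt (𝓡 7) x₀).target) :
    chartForm α x₀ y (fun i => chartField (X i) x₀ y)
      = α ((extChartAt (𝓡 7) x₀).symm y) (fun i => X i ((extChartAt (𝓡 7) x₀).symm y)) := by
  have hinv := isInvertible_mfderivWithin_extChartAt_symm (I := 𝓡 7) hy
  rw [ModelWithCorners.range_eq_univ (𝓡 7), mfderivWithin_univ] at hinv
  have key : ∀ i, (mfderiv 𝓘(ℝ, E7) (𝓡 7) (extChartAt (𝓡 7) x₀).symm y)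
      (chartField (X i) x₀ y) = X i ((extChartAt (𝓡 7) x₀).symm y) := by
    intro i
    have := hinv.self_apply_inverse (X i ((extChartAt (𝓡 7) x₀).symm y))
    rwa [← mfderivWithin_univ, ← ModelWithCorners.range_eq_univ (𝓡 7)] at this ⊢
  exact congrArg (α ((extChartAt (𝓡 7) x₀).symm y)) (funext key)

lemma chartField_self (X : ∀ x : K, TangentSpace (𝓡 7) x) (x : K) :
    chartField X x (extChartAt (𝓡 7) x x) = (X x : E7) := by
  have h := mfderivWithin_extChartAt_symm_inverse_apply (I := 𝓡 7) (x := x)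
    (X ((extChartAt (𝓡 7) x).symm (extChartAt (𝓡 7) x x)))
  refine Eq.trans h ?_
  exact congrArg (fun y => (X y : E7)) (extChartAt_to_inv (I := 𝓡 7) x)

lemma DiffFieldAt.differentiableAt_chartField {X : ∀ x : K, TangentSpace (𝓡 7) x} {x : K}
    (hX : DiffFieldAt X x) : DifferentiableAt ℝ (chartField X x) (extChartAt (𝓡 7) x x) := by
  have h := (mdifferentiableWithinAt_univ.2 hX).differentiableWithinAt_mpullbackWithin_vectorField
  have hs : (extChartAt (𝓡 7) x).symm ⁻¹' Set.univ ∩ Set.range (𝓡 7) = Set.univ := by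
    rw [ModelWithCorners.range_eq_univ, Set.preimage_univ, Set.univ_inter]
  rw [hs] at h
  exact differentiableWithinAt_univ.1 h

lemma SmoothFieldAt.diffFieldAt {X : ∀ x : K, TangentSpace (𝓡 7) x} {x : K}
    (hX : SmoothFieldAt X x) : DiffFieldAt X x :=
  ContMDiffAt.mdifferentiableAt hX (by simp)

lemma mlieBracket_eq_lieBracket_chartField (X Y : ∀ x : K, TangentSpace (𝓡 7) x) (x : K) :
    (VectorField.mlieBracket (𝓡 7) X Y x : E7) =
      VectorField.lieBracket ℝ (chartField X x) (chartField Y x) (extChartAt (𝓡 7) x x) := by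
  have hs : (extChartAt (𝓡 7) x).symm ⁻¹' Set.univ ∩ Set.range (𝓡 7) = Set.univ := by
    rw [ModelWithCorners.range_eq_univ, Set.preimage_univ, Set.univ_inter]
  rw [← VectorField.mlieBracketWithin_univ, VectorField.mlieBracketWithin_apply,
    mfderiv_extChartAt_self, hs]
  refine (congrFun (congrArg DFunLike.coe (ContinuousLinearMap.inverse_id (R := ℝ) (M := E7)))
    _).trans ?_
  exact congrFun (VectorField.lieBracketWithin_univ (𝕜 := ℝ) (E := E7)) _

lemma hasMFDerivAt_form_apply {n : ℕ} {F : Type*} [NormedAddCommGroup F] [NormedSpace ℝ F]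
    {α : ∀ x : K, TangentSpace (𝓡 7) x [⋀^Fin n]→L[ℝ] F} {U : Set K} (hα : SmoothFormOn α U)
    (hU : IsOpen U) {x : K} (hx : x ∈ U) {X : Fin n → ∀ x : K, TangentSpace (𝓡 7) x}
    (hX : ∀ i, DiffFieldAt (X i) x) :
    HasMFDerivAt (𝓡 7) 𝓘(ℝ, F) (fun y => α y (fun i => X i y)) x
      (fderiv ℝ (fun y => chartForm α x y (fun i => chartField (X i) x y))
        (extChartAt (𝓡 7) x x) : E7 →L[ℝ] F) := by
  refine hasMFDerivAt_of_chart ?_ ?_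
  · exact (hα.differentiableAt_chartForm hU hx).continuousAlternatingMap_apply
      fun i => (hX i).differentiableAt_chartField
  · filter_upwards [extChartAt_target_mem_nhds (I := 𝓡 7) x] with y hy
    exact chartForm_apply_chartField α X x hy

/-- The exterior derivative in terms of vector fields and Lie brackets. -/
theorem mextDeriv_apply_vectorField {n : ℕ} {F : Type*} [NormedAddCommGroup F] [NormedSpace ℝ F]
    {α : ∀ x : K, TangentSpace (𝓡 7) x [⋀^Fin (n + 1)]→L[ℝ] F} {U : Set K}
    (hα : SmoothFormOn α U) (hU : IsOpen U) {x : K} (hx : x ∈ U)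
    {X : Fin (n + 2) → ∀ x : K, TangentSpace (𝓡 7) x} (hX : ∀ i, DiffFieldAt (X i) x) :
    mextDeriv α x (fun i => X i x) =
      (∑ i : Fin (n + 2), (-1) ^ i.val •
        mvfderiv (𝓡 7) (fun y => α y (i.removeNth fun j => X j y)) x (X i x)) -
        ∑ i : Fin (n + 1), ∑ j ≥ i, (-1) ^ (i + j : ℕ) •
          α x (Matrix.vecCons (VectorField.mlieBracket (𝓡 7) (X i.castSucc) (X j.succ) x)
              (j.removeNth <| i.castSucc.removeNth fun k => X k x)) := by
  have key := extDeriv_apply_vectorField (hα.differentiableAt_chartForm hU hx)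
    (V := fun i => chartField (X i) x) (fun i => (hX i).differentiableAt_chartField)
  have h1 : mextDeriv α x (fun i => X i x) = extDeriv (chartForm α x) (extChartAt (𝓡 7) x x)
      (fun i => chartField (X i) x (extChartAt (𝓡 7) x x)) := by
    have : ∀ i, (mfderiv (𝓡 7) 𝓘(ℝ, E7) (extChartAt (𝓡 7) x) x (X i x) : E7)
        = chartField (X i) x (extChartAt (𝓡 7) x x) := by
      intro i
      rw [chartField_self, mfderiv_extChartAt_self]; rfl
    exact congrArg (extDeriv (chartForm α x) (extChartAt (𝓡 7) x x)) (funext this)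
  rw [h1, key]
  congr 1
  · refine Finset.sum_congr rfl fun i _ => ?_
    congr 1
    have h2 := (hasMFDerivAt_form_apply hα hU hx (X := i.removeNth X)
      (fun j => hX _)).mfderiv
    rw [chartField_self]
    exact (congrArg (fun L : E7 →L[ℝ] F => L (X i x)) h2).symm
  · refine Finset.sum_congr rfl fun i _ => Finset.sum_congr rfl fun j _ => ?_
    congr 1
    have h3 : ∀ v : Fin (n + 1) → E7, chartForm α x (extChartAt (𝓡 7) x x) v = α x v := by
      intro v
      have := chartForm_apply_chartField α (fun i _ => v i) x (mem_extChartAt_target (I := 𝓡 7) x)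
      have h4 : (fun i => chartField (fun _ : K => v i) x (extChartAt (𝓡 7) x x)) = v :=
        funext fun i => chartField_self (fun _ : K => v i) x
      rw [h4] at this
      exact this.trans (congrArg (fun y => (α y : E7 [⋀^Fin (n + 1)]→L[ℝ] F) v)
        (extChartAt_to_inv (I := 𝓡 7) x))
    rw [h3]
    have h5 : (fun k => chartField (X k) x (extChartAt (𝓡 7) x x)) = fun k => (X k x : E7) :=
      funext fun k => chartField_self (X k) x
    rw [h5, ← mlieBracket_eq_lieBracket_chartField]
    rfl

/-- The pairing of a smooth `1`-form with a differentiable vector field is differentiable. -/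
lemma DiffFieldAt.mdifferentiableAt_oneForm {α : ∀ x : K, TangentSpace (𝓡 7) x →L[ℝ] ℝ} {U : Set K}
    (hα : SmoothFormOn (oneForm α) U) (hU : IsOpen U) {x : K} (hx : x ∈ U)
    {X : ∀ x : K, TangentSpace (𝓡 7) x} (hX : DiffFieldAt X x) :
    MDifferentiableAt (𝓡 7) 𝓘(ℝ, ℝ) (fun y => α y (X y)) x :=
  (hasMFDerivAt_form_apply hα hU hx (X := fun _ => X) fun _ => hX).mdifferentiableAt

/-- `dα(X, Y) = X(α(Y)) - Y(α(X)) - α([X, Y])`. -/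
lemma mextDeriv_oneForm_apply {α : ∀ x : K, TangentSpace (𝓡 7) x →L[ℝ] ℝ} {U : Set K}
    (hα : SmoothFormOn (oneForm α) U) (hU : IsOpen U) {x : K} (hx : x ∈ U)
    {X Y : ∀ x : K, TangentSpace (𝓡 7) x} (hX : DiffFieldAt X x) (hY : DiffFieldAt Y x) :
    mextDeriv (oneForm α) x ![X x, Y x] =
      mvfderiv (𝓡 7) (fun y => α y (Y y)) x (X x) - mvfderiv (𝓡 7) (fun y => α y (X y)) x (Y x)
        - α x (VectorField.mlieBracket (𝓡 7) X Y x) := by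
  have h := mextDeriv_apply_vectorField hα hU hx (X := ![X, Y])
    (by intro i; fin_cases i <;> assumption)
  have e1 : (fun i => (![X, Y] : Fin 2 → ∀ x : K, TangentSpace (𝓡 7) x) i x) = ![X x, Y x] := by
    funext i; fin_cases i <;> rfl
  rw [e1] at h
  rw [h]
  have hI : Finset.Ici (0 : Fin 1) = {0} := by decide
  rw [Fin.sum_univ_two, Fin.sum_univ_one, hI, Finset.sum_singleton]
  have e2 : ∀ p q r : ℝ, (-1 : ℤ) ^ 0 • p + (-1 : ℤ) ^ 1 • q - (-1 : ℤ) ^ (0 + 0) • r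
      = p - q - r := by
    intro p q r; simp [sub_eq_add_neg]
  exact e2 (mvfderiv (𝓡 7) (fun y => α y (Y y)) x (X x))
    (mvfderiv (𝓡 7) (fun y => α y (X y)) x (Y x)) (α x (VectorField.mlieBracket (𝓡 7) X Y x))

/-- The exterior derivative of a `3`-form on four vector fields on which the form is constant. -/
lemma mextDeriv_threeForm_apply {F : Type*} [NormedAddCommGroup F] [NormedSpace ℝ F]
    {α : ∀ x : K, TangentSpace (𝓡 7) x [⋀^Fin 3]→L[ℝ] F} {U : Set K}
    (hα : SmoothFormOn α U) (hU : IsOpen U) {x : K} (hx : x ∈ U)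
    {X : Fin 4 → ∀ x : K, TangentSpace (𝓡 7) x} (hX : ∀ i, DiffFieldAt (X i) x)
    (hc : ∀ i j k, ∃ a : F, ∀ᶠ y in 𝓝 x, α y ![X i y, X j y, X k y] = a) :
    mextDeriv α x (fun i => X i x) =
      - α x ![VectorField.mlieBracket (𝓡 7) (X 0) (X 1) x, X 2 x, X 3 x]
      + α x ![VectorField.mlieBracket (𝓡 7) (X 0) (X 2) x, X 1 x, X 3 x]
      - α x ![VectorField.mlieBracket (𝓡 7) (X 0) (X 3) x, X 1 x, X 2 x]
      - α x ![VectorField.mlieBracket (𝓡 7) (X 1) (X 2) x, X 0 x, X 3 x]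
      + α x ![VectorField.mlieBracket (𝓡 7) (X 1) (X 3) x, X 0 x, X 2 x]
      - α x ![VectorField.mlieBracket (𝓡 7) (X 2) (X 3) x, X 0 x, X 1 x] := by
  -- only the bracket terms of the general formula survive
  rw [mextDeriv_apply_vectorField hα hU hx hX, Finset.sum_eq_zero, zero_sub]
  · have hI0 : Finset.Ici (0 : Fin 3) = {0, 1, 2} := by decide
    have hI1 : Finset.Ici (1 : Fin 3) = {1, 2} := by decide
    have hI2 : Finset.Ici (2 : Fin 3) = {2} := by decide
    rw [Fin.sum_univ_three, hI0, hI1, hI2]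
    have r : ∀ (i j : Fin 3) (k l : Fin 4),
        (j.removeNth (i.castSucc.removeNth fun k => X k x)) 0 = X k x →
        (j.removeNth (i.castSucc.removeNth fun k => X k x)) 1 = X l x →
        j.removeNth (i.castSucc.removeNth fun k => X k x) = ![X k x, X l x] := by
      intro i j k l h0 h1
      funext a
      fin_cases a
      · exact h0
      · exact h1
    rw [Finset.sum_insert (by decide), Finset.sum_insert (by decide), Finset.sum_singleton,
      Finset.sum_insert (by decide), Finset.sum_singleton, Finset.sum_singleton,
      r 0 0 2 3 rfl rfl, r 0 1 1 3 rfl rfl, r 0 2 1 2 rfl rfl, r 1 1 0 3 rfl rfl,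
      r 1 2 0 2 rfl rfl, r 2 2 0 1 rfl rfl]
    have e : ∀ a b c d e f : F,
        -((-1 : ℤ) ^ (0 + 0) • a + ((-1 : ℤ) ^ (0 + 1) • b + (-1 : ℤ) ^ (0 + 2) • c)
          + ((-1 : ℤ) ^ (1 + 1) • d + (-1 : ℤ) ^ (1 + 2) • e) + (-1 : ℤ) ^ (2 + 2) • f)
        = -a + b - c - d + e - f := by
      intro a b c d e f
      norm_num
      abel
    exact e _ _ _ _ _ _
  · intro i _
    obtain ⟨a, ha⟩ := hc (i.succAbove 0) (i.succAbove 1) (i.succAbove 2)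
    have : mvfderiv (𝓡 7) (fun y => α y (i.removeNth fun j => X j y)) x = 0 := by
      have he : ∀ y, (fun l : Fin 3 => (i.removeNth fun j => X j y) l)
          = ![X (i.succAbove 0) y, X (i.succAbove 1) y, X (i.succAbove 2) y] := by
        intro y; funext l; fin_cases l <;> rfl
      have h0 : HasMFDerivAt (𝓡 7) 𝓘(ℝ, F) (fun y => α y (i.removeNth fun j => X j y)) x 0 := by
        refine (hasMFDerivAt_const a x).congr_of_eventuallyEq ?_
        filter_upwards [ha] with y hy
        rw [← hy, ← he y]
      ext v
      simp [mvfderiv, h0.mfderiv]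
    rw [this, zero_apply, smul_zero]

end Calculus

/-! ### Coframes, connection matrices and curvature matrices -/

section Frames

variable {K : Type*} [TopologicalSpace K] [ChartedSpace E7 K]

lemma SmoothFormOn.mono {n : ℕ} {F : Type*} [NormedAddCommGroup F] [NormedSpace ℝ F]
    {α : ∀ x : K, TangentSpace (𝓡 7) x [⋀^Fin n]→L[ℝ] F} {U V : Set K}
    (hα : SmoothFormOn α V) (h : U ⊆ V) : SmoothFormOn α U :=
  fun x₀ => (hα x₀).mono (Set.inter_subset_inter_right _ (Set.preimage_mono h))

lemma SmoothFormOn.const_smul_oneForm {α : ∀ x : K, TangentSpace (𝓡 7) x →L[ℝ] ℝ} {U : Set K}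
    (hα : SmoothFormOn (oneForm α) U) (r : ℝ) : SmoothFormOn (oneForm fun x => r • α x) U :=
  fun x₀ => (hα x₀).const_smul r

variable [IsManifold (𝓡 7) ∞ K]

/-- A covariant derivative is additive over finite sums of differentiable sections. -/
lemma TangentConnection.sum_apply (D : TangentConnection K) {ι : Type*} (s : Finset ι)
    {σ : ι → ∀ y : K, TangentSpace (𝓡 7) y} {x : K} (hσ : ∀ i, DiffFieldAt (σ i) x) :
    D (fun y => ∑ i ∈ s, σ i y) x = ∑ i ∈ s, D (σ i) x := by
  classical
  induction s using Finset.induction_on with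
  | empty => simpa only [Finset.sum_empty] using! congrFun D.zero x
  | insert i s hi ih =>
    rw [Finset.sum_insert hi, ← ih]
    have h := D.isCovariantDerivativeOnUniv.add (hσ i)
      (MDifferentiableAt.sum_section (s := s) fun j _ => hσ j)
    rw [← h]
    congr 1
    funext y
    simp [Finset.sum_insert hi]

namespace ContactCalabiYau

variable (S : ContactCalabiYau K)

/-- `Jξ = rξ` for some `r`, because `J² (Jξ) = J (J² ξ) = 0`; then `J²ξ = 0` gives `r = 0`. -/
lemma J_ξ (x : K) : S.J x (S.ξ x) = 0 := by
  have h0 : S.J x (S.J x (S.ξ x)) = 0 := by rw [S.J_sq, S.η_ξ]; simp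
  have h1 := S.J_sq x (S.J x (S.ξ x))
  rw [h0, map_zero] at h1
  have h2 : S.J x (S.ξ x) = S.η x (S.J x (S.ξ x)) • S.ξ x := by
    have := h1.symm
    rw [neg_add_eq_zero] at this
    exact this
  have h3 : S.η x (S.J x (S.ξ x)) = 0 := by
    set r := S.η x (S.J x (S.ξ x))
    rw [h2, map_smul, h2, smul_smul] at h0
    have h5 := congrArg (S.η x) h0
    rw [map_smul, S.η_ξ, map_zero, smul_eq_mul, mul_one] at h5
    exact mul_self_eq_zero.1 h5
  rw [h2, h3, zero_smul]

lemma η_J (x : K) (v : TangentSpace (𝓡 7) x) : S.η x (S.J x v) = 0 := by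
  have h1 := S.J_sq x (S.J x v)
  rw [S.J_sq x v, map_add, map_neg, map_smul, J_ξ, smul_zero, add_zero] at h1
  have h2 : S.η x (S.J x v) • S.ξ x = 0 := by
    simpa using h1.symm
  have h5 := congrArg (S.η x) h2
  rwa [map_smul, S.η_ξ, map_zero, smul_eq_mul, mul_one] at h5

namespace Coframe

variable {S} (c : S.Coframe) {x : K} {ε : ℝ}

lemma e_J (hx : x ∈ c.U) (i : Fin 3) (v : TangentSpace (𝓡 7) x) :
    c.e i x (S.J x v) = - c.Je i x v := by
  rw [c.Je_eq i x hx, neg_neg]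

lemma Je_ξ (hx : x ∈ c.U) (i : Fin 3) : c.Je i x (S.ξ x) = 0 := by
  rw [c.Je_eq i x hx, S.J_ξ, map_zero, neg_zero]

lemma Je_J (hx : x ∈ c.U) (i : Fin 3) (v : TangentSpace (𝓡 7) x) :
    c.Je i x (S.J x v) = c.e i x v := by
  rw [c.Je_eq i x hx, S.J_sq, map_add, map_smul, c.e_ξ i x hx]; simp

/-- The coframe and the frame are dual. -/
lemma coframe_frame (hx : x ∈ c.U) (hε : ε ≠ 0) (a b : Idx) :
    c.coframe ε a x (c.frame ε b x) = if a = b then 1 else 0 := by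
  rcases a with _ | i | i <;> rcases b with _ | j | j <;>
    simp [coframe, frame, S.η_ξ, c.η_u _ x hx, S.η_J, c.e_ξ _ x hx, c.Je_ξ hx, c.e_u _ _ x hx,
      c.Je_u _ _ x hx, c.e_J hx, c.Je_J hx, hε]

lemma gV_eq (hx : x ∈ c.U) (v w : TangentSpace (𝓡 7) x) :
    S.gV x v w = ∑ i, (c.e i x v * c.e i x w + c.Je i x v * c.Je i x w) := by
  rw [gV, c.ω_eq x hx]
  refine Finset.sum_congr rfl fun i _ => ?_
  simp [wedge₁₁, c.e_J hx, c.Je_J hx]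

/-- The coframe is `g_ε`-orthonormal. -/
lemma g_eq (hx : x ∈ c.U) (v w : TangentSpace (𝓡 7) x) :
    S.g ε x v w = ∑ a, c.coframe ε a x v * c.coframe ε a x w := by
  rw [g, c.gV_eq hx]
  simp [coframe, Finset.sum_add_distrib]
  ring

lemma eq_of_coframe_eq (hx : x ∈ c.U) (hε : ε ≠ 0) {v w : TangentSpace (𝓡 7) x}
    (h : ∀ a, c.coframe ε a x v = c.coframe ε a x w) : v = w := by
  by_contra hne
  have hz : ∀ a, c.coframe ε a x (v - w) = 0 := fun a => by rw [map_sub, h, sub_self]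
  have hη : S.η x (v - w) = 0 := by
    have := hz (.inl ())
    simpa [coframe, hε] using this
  have hp := S.positive x (v - w) hη (sub_ne_zero.2 hne)
  have hg := c.gV_eq hx (v - w) (v - w)
  rw [gV, kaehler] at hg
  rw [hg] at hp
  refine hp.ne' (Finset.sum_eq_zero fun i _ => ?_)
  have h1 := hz (.inr (.inl i))
  have h2 := hz (.inr (.inr i))
  simp only [coframe] at h1 h2
  rw [h1, h2]; simp

lemma sum_coframe_smul_frame (hx : x ∈ c.U) (hε : ε ≠ 0) (v : TangentSpace (𝓡 7) x) :
    v = ∑ a, c.coframe ε a x v • c.frame ε a x := by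
  refine c.eq_of_coframe_eq hx hε fun b => ?_
  rw [map_sum]
  simp only [map_smul, c.coframe_frame hx hε, smul_eq_mul, mul_ite, mul_one, mul_zero,
    Finset.sum_ite_eq, Finset.mem_univ, if_true]

lemma smoothFieldAt_frame (hx : x ∈ c.U) (a : Idx) : SmoothFieldAt (c.frame ε a) x := by
  rcases a with _ | i | i
  · exact ContMDiffAt.const_smul_section (a := ε⁻¹) (S.smooth_ξ x)
  · exact c.smooth_u i x hx
  · exact S.smooth_J _ x (c.smooth_u i x hx)

lemma smooth_coframe (a : Idx) : SmoothFormOn (oneForm (c.coframe ε a)) c.U := by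
  rcases a with _ | i | i
  · exact (S.smooth_η.mono (Set.subset_univ _)).const_smul_oneForm ε
  · exact c.smooth_e i
  · exact c.smooth_Je i

lemma mdifferentiableAt_coframe (hx : x ∈ c.U) (a : Idx) {X : ∀ y : K, TangentSpace (𝓡 7) y}
    (hX : DiffFieldAt X x) : MDifferentiableAt (𝓡 7) 𝓘(ℝ, ℝ) (fun y => c.coframe ε a y (X y)) x :=
  hX.mdifferentiableAt_oneForm (c.smooth_coframe a) c.isOpen_U hx

/-- A vector field is differentiable once its components in a coframe are. -/
lemma diffFieldAt_of_coframe (hx : x ∈ c.U) (hε : ε ≠ 0) {X : ∀ y : K, TangentSpace (𝓡 7) y}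
    (h : ∀ a, MDifferentiableAt (𝓡 7) 𝓘(ℝ, ℝ) (fun y => c.coframe ε a y (X y)) x) :
    DiffFieldAt X x := by
  have h1 : DiffFieldAt (fun y => ∑ a, c.coframe ε a y (X y) • c.frame ε a y) x :=
    MDifferentiableAt.sum_section fun a _ =>
      (h a).smul_section (c.smoothFieldAt_frame hx a).diffFieldAt
  refine MDifferentiableAt.congr_of_eventuallyEq h1 ?_
  filter_upwards [c.isOpen_U.mem_nhds hx] with y hy
  rw [← c.sum_coframe_smul_frame hy hε]

/-- The components of a covariant derivative in terms of the connection matrix. -/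
lemma coframe_covariantDerivative (hx : x ∈ c.U) (hε : ε ≠ 0) (D : TangentConnection K)
    {Z : ∀ y : K, TangentSpace (𝓡 7) y} (hZ : DiffFieldAt Z x) (a : Idx)
    (v : TangentSpace (𝓡 7) x) :
    c.coframe ε a x (D Z x v) = mvfderiv (𝓡 7) (fun y => c.coframe ε a y (Z y)) x v
      + ∑ b, c.connMatrix ε D x a b v * c.coframe ε b x (Z x) := by
  have hF : ∀ b, DiffFieldAt (fun y => c.coframe ε b y (Z y) • c.frame ε b y) x := fun b =>
    (c.mdifferentiableAt_coframe hx b hZ).smul_section (c.smoothFieldAt_frame hx b).diffFieldAt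
  have h1 : D Z x = D (fun y => ∑ b, c.coframe ε b y (Z y) • c.frame ε b y) x := by
    refine D.isCovariantDerivativeOnUniv.congr_of_eventuallyEq hZ
      (MDifferentiableAt.sum_section fun b _ => hF b) Filter.univ_mem ?_
    filter_upwards [c.isOpen_U.mem_nhds hx] with y hy
    exact c.sum_coframe_smul_frame hy hε (Z y)
  have h2 : ∀ b, D (fun y => c.coframe ε b y (Z y) • c.frame ε b y) x v
      = c.coframe ε b x (Z x) • D (c.frame ε b) x v
        + mvfderiv (𝓡 7) (fun y => c.coframe ε b y (Z y)) x v • c.frame ε b x := by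
    intro b
    have := D.isCovariantDerivativeOnUniv.leibniz (c.smoothFieldAt_frame (ε := ε) hx b).diffFieldAt
      (c.mdifferentiableAt_coframe (ε := ε) hx b hZ)
    exact congrArg (fun L => L v) this
  rw [h1, TangentConnection.sum_apply D _ hF]
  simp only [sum_apply, h2, map_sum, map_add, map_smul, smul_eq_mul,
    c.coframe_frame hx hε, Finset.sum_add_distrib, mul_ite, mul_one, mul_zero,
    Finset.sum_ite_eq, Finset.mem_univ, if_true, connMatrix, ContinuousLinearMap.comp_apply]
  rw [add_comm]
  congr 1
  exact Finset.sum_congr rfl fun b _ => mul_comm _ _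

/-- Cartan's formula: the curvature matrix is `dΘ + Θ ∧ Θ`, evaluated on vector fields. -/
lemma curvMatrix_apply (hx : x ∈ c.U) (hε : ε ≠ 0) (D : TangentConnection K)
    {X Y : ∀ y : K, TangentSpace (𝓡 7) y}
    (hX : ∀ a b, MDifferentiableAt (𝓡 7) 𝓘(ℝ, ℝ) (fun y => c.connMatrix ε D y a b (X y)) x)
    (hY : ∀ a b, MDifferentiableAt (𝓡 7) 𝓘(ℝ, ℝ) (fun y => c.connMatrix ε D y a b (Y y)) x)
    (a b : Idx) :
    c.curvMatrix ε D X Y x a b =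
      mvfderiv (𝓡 7) (fun y => c.connMatrix ε D y a b (Y y)) x (X x)
        - mvfderiv (𝓡 7) (fun y => c.connMatrix ε D y a b (X y)) x (Y x)
        - c.connMatrix ε D x a b (VectorField.mlieBracket (𝓡 7) X Y x)
        + ∑ d, (c.connMatrix ε D x a d (X x) * c.connMatrix ε D x d b (Y x)
          - c.connMatrix ε D x a d (Y x) * c.connMatrix ε D x d b (X x)) := by
  have key : ∀ (X Y : ∀ y : K, TangentSpace (𝓡 7) y),
      (∀ a b, MDifferentiableAt (𝓡 7) 𝓘(ℝ, ℝ) (fun y => c.connMatrix ε D y a b (Y y)) x) →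
      c.coframe ε a x (D (fun y => D (c.frame ε b) y (Y y)) x (X x)) =
        mvfderiv (𝓡 7) (fun y => c.connMatrix ε D y a b (Y y)) x (X x)
          + ∑ d, c.connMatrix ε D x a d (X x) * c.connMatrix ε D x d b (Y x) := by
    intro X Y hY
    exact c.coframe_covariantDerivative hx hε D
      (c.diffFieldAt_of_coframe hx hε fun d => hY d b) a (X x)
  rw [curvMatrix, curvatureOp, map_sub, map_sub, key X Y hY, key Y X hX, Finset.sum_sub_distrib]
  simp only [connMatrix, ContinuousLinearMap.comp_apply]
  ring

end Coframe

end ContactCalabiYau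

end Frames

/-! ### Lie brackets of the frame -/

section Structure

/-- The sign in `J E_b = ± E_{b'}`, where `b ↦ b'` exchanges the two halves of the index set of the
horizontal frame `(u, Ju)`. -/
def sgn : Fin 3 ⊕ Fin 3 → ℝ := Sum.elim (fun _ => 1) (fun _ => -1)

/-- The algebraic form of the fact that an almost Hermitian structure with closed fundamental form
and vanishing Nijenhuis tensor is parallel: `G` stands for the coefficients of the Levi-Civita
connection in an orthonormal frame `(u, Ju)`, and `β` for those of the Lie brackets. -/
lemma unitary_of_kaehler_of_integrable {G : Fin 3 ⊕ Fin 3 → Fin 3 ⊕ Fin 3 → Fin 3 ⊕ Fin 3 → ℝ}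
    {β : Fin 3 ⊕ Fin 3 → Fin 3 ⊕ Fin 3 → Fin 3 ⊕ Fin 3 → ℝ}
    (hG : ∀ a b d, G a b d = - G b a d)
    (hβ : ∀ a b d, β a b d = G d b a - G d a b)
    (hω : ∀ a b d, sgn d * β a b d.swap + sgn a * β b d a.swap + sgn b * β d a b.swap = 0)
    (hN : ∀ a b d, - β b d a + sgn b * sgn d * β b.swap d.swap a
      + sgn a * sgn b * β b.swap d a.swap + sgn a * sgn d * β b d.swap a.swap = 0)
    (a b d : Fin 3 ⊕ Fin 3) : sgn b * G a b.swap d + sgn a * G a.swap b d = 0 := by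
  simp only [hβ] at hω hN
  -- the claim is a linear combination of closedness on `(E_d, E_b, E_a)` and `(E_d, JE_b, JE_a)`
  -- and integrability on `(JE_d, E_b, E_a)`
  have h1 := hω d b a
  have h2 := hω d b.swap a.swap
  have h3 := hN d.swap b a
  rcases a with i | i <;> rcases b with j | j <;> rcases d with l | l <;>
  simp only [sgn, Sum.swap_inl, Sum.swap_inr, Sum.elim_inl, Sum.elim_inr] at h1 h2 h3 ⊢ <;>
  linarith [hG (.inl i) (.inl j) (.inl l), hG (.inl i) (.inr j) (.inl l),
    hG (.inr i) (.inl j) (.inl l), hG (.inr i) (.inr j) (.inl l),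
    hG (.inl i) (.inl j) (.inr l), hG (.inl i) (.inr j) (.inr l),
    hG (.inr i) (.inl j) (.inr l), hG (.inr i) (.inr j) (.inr l),
    hG (.inl i) (.inl l) (.inl j), hG (.inl i) (.inr l) (.inl j),
    hG (.inr i) (.inl l) (.inl j), hG (.inr i) (.inr l) (.inl j),
    hG (.inl i) (.inl l) (.inr j), hG (.inl i) (.inr l) (.inr j),
    hG (.inr i) (.inl l) (.inr j), hG (.inr i) (.inr l) (.inr j),
    hG (.inl j) (.inl l) (.inl i), hG (.inl j) (.inr l) (.inl i),
    hG (.inr j) (.inl l) (.inl i), hG (.inr j) (.inr l) (.inl i),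
    hG (.inl j) (.inl l) (.inr i), hG (.inl j) (.inr l) (.inr i),
    hG (.inr j) (.inl l) (.inr i), hG (.inr j) (.inr l) (.inr i)]

variable {K : Type*} [TopologicalSpace K] [ChartedSpace E7 K]

lemma hasMFDerivAt_zero_of_eventually_const {F : Type*} [NormedAddCommGroup F] [NormedSpace ℝ F]
    {f : K → F} {x : K} {a : F} (h : ∀ᶠ y in 𝓝 x, f y = a) :
    HasMFDerivAt (𝓡 7) 𝓘(ℝ, F) f x 0 := by
  refine (hasMFDerivAt_const a x).congr_of_eventuallyEq ?_
  filter_upwards [h] with y hy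
  rw [hy]

lemma mvfderiv_eq_zero_of_eventually_const {F : Type*} [NormedAddCommGroup F] [NormedSpace ℝ F]
    {f : K → F} {x : K} {a : F} (h : ∀ᶠ y in 𝓝 x, f y = a) : mvfderiv (𝓡 7) f x = 0 := by
  ext v
  simp [mvfderiv, (hasMFDerivAt_zero_of_eventually_const h).mfderiv]

variable [IsManifold (𝓡 7) ∞ K]

/-- A `1`-form that is constant on `X` and on `Y` satisfies `dα(X, Y) = - α([X, Y])`. -/
lemma mextDeriv_oneForm_apply_of_const {α : ∀ x : K, TangentSpace (𝓡 7) x →L[ℝ] ℝ} {U : Set K}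
    (hα : SmoothFormOn (oneForm α) U) (hU : IsOpen U) {x : K} (hx : x ∈ U)
    {X Y : ∀ x : K, TangentSpace (𝓡 7) x} (hX : DiffFieldAt X x) (hY : DiffFieldAt Y x) {r s : ℝ}
    (hr : ∀ᶠ y in 𝓝 x, α y (X y) = r) (hs : ∀ᶠ y in 𝓝 x, α y (Y y) = s) :
    mextDeriv (oneForm α) x ![X x, Y x] = - α x (VectorField.mlieBracket (𝓡 7) X Y x) := by
  rw [mextDeriv_oneForm_apply hα hU hx hX hY, mvfderiv_eq_zero_of_eventually_const hr,
    mvfderiv_eq_zero_of_eventually_const hs]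
  simp

lemma SmoothFieldAt.mlieBracket {X Y : ∀ x : K, TangentSpace (𝓡 7) x} {x : K}
    (hX : SmoothFieldAt X x) (hY : SmoothFieldAt Y x) :
    SmoothFieldAt (VectorField.mlieBracket (𝓡 7) X Y) x := by
  have : IsManifold (𝓡 7) (minSmoothness ℝ 2) K :=
    IsManifold.of_le (n := ∞) (by rw [minSmoothness_of_isRCLikeNormedField]; exact ENat.LEInfty.out)
  have : IsManifold (𝓡 7) (((⊤ : ℕ∞) : WithTop ℕ∞) + 1) K := inferInstanceAs (IsManifold (𝓡 7) ∞ K)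
  exact ContMDiffAt.mlieBracket_vectorField (m := ⊤) (n := ⊤) hX hY (by simp)

namespace ContactCalabiYau

variable (S : ContactCalabiYau K)

lemma kaehler_swap (x : K) (v w : TangentSpace (𝓡 7) x) : S.kaehler x v w = - S.kaehler x w v := by
  have h := (mextDeriv (oneForm S.η) x).map_swap ![w, v] (i := 0) (j := 1) (by decide)
  refine Eq.trans (congrArg (mextDeriv (oneForm S.η) x) ?_) h
  funext i
  fin_cases i <;> rfl

namespace Coframe

variable {S} (c : S.Coframe) {x : K} {ε : ℝ}

lemma eventually_coframe_frame (hx : x ∈ c.U) (hε : ε ≠ 0) (a b : Idx) :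
    ∀ᶠ y in 𝓝 x, c.coframe ε a y (c.frame ε b y) = if a = b then 1 else 0 := by
  filter_upwards [c.isOpen_U.mem_nhds hx] with y hy
  exact c.coframe_frame hy hε a b

lemma η_frame (hx : x ∈ c.U) (b : Fin 3 ⊕ Fin 3) : S.η x (c.frame ε (.inr b) x) = 0 := by
  rcases b with j | j
  · exact c.η_u j x hx
  · exact S.η_J x _

lemma eventually_η_frame (hx : x ∈ c.U) (b : Fin 3 ⊕ Fin 3) :
    ∀ᶠ y in 𝓝 x, S.η y (c.frame ε (.inr b) y) = 0 := by
  filter_upwards [c.isOpen_U.mem_nhds hx] with y hy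
  exact c.η_frame hy b

lemma J_frame (hx : x ∈ c.U) (b : Fin 3 ⊕ Fin 3) :
    S.J x (c.frame ε (.inr b) x) = sgn b • c.frame ε (.inr b.swap) x := by
  rcases b with j | j
  · simp [frame, sgn]
  · simp [frame, sgn, S.J_sq, c.η_u j x hx]

lemma coframe_J (hx : x ∈ c.U) (a : Fin 3 ⊕ Fin 3) (v : TangentSpace (𝓡 7) x) :
    c.coframe ε (.inr a) x (S.J x v) = - (sgn a * c.coframe ε (.inr a.swap) x v) := by
  rcases a with i | i
  · simp [coframe, sgn, c.e_J hx]
  · simp [coframe, sgn, c.Je_J hx]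

lemma coframe_ξ (hx : x ∈ c.U) (a : Fin 3 ⊕ Fin 3) : c.coframe ε (.inr a) x (S.ξ x) = 0 := by
  rcases a with i | i
  · exact c.e_ξ i x hx
  · exact c.Je_ξ hx i

lemma kaehler_frame (hx : x ∈ c.U) (hε : ε ≠ 0) (v : TangentSpace (𝓡 7) x) (d : Fin 3 ⊕ Fin 3) :
    S.kaehler x v (c.frame ε (.inr d) x) = - (sgn d * c.coframe ε (.inr d.swap) x v) := by
  have h1 := c.coframe_frame hx hε
  rw [c.ω_eq x hx]
  have h2 : ∀ i, c.e i x (c.frame ε (.inr d) x) = if (Sum.inl i) = d then 1 else 0 := by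
    intro i; simpa [coframe] using h1 (.inr (.inl i)) (.inr d)
  have h3 : ∀ i, c.Je i x (c.frame ε (.inr d) x) = if (Sum.inr i) = d then 1 else 0 := by
    intro i; simpa [coframe] using h1 (.inr (.inr i)) (.inr d)
  rcases d with i | i <;> simp [wedge₁₁, h2, h3, coframe, sgn]

/-- The structure equation `dη = ω` on the horizontal frame. -/
lemma η_mlieBracket_frame (hx : x ∈ c.U) (a b : Fin 3 ⊕ Fin 3) :
    S.η x (VectorField.mlieBracket (𝓡 7) (c.frame ε (.inr a)) (c.frame ε (.inr b)) x)
      = - S.kaehler x (c.frame ε (.inr a) x) (c.frame ε (.inr b) x) := by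
  have h := mextDeriv_oneForm_apply_of_const (S.smooth_η.mono (Set.subset_univ c.U)) c.isOpen_U hx
    (c.smoothFieldAt_frame (ε := ε) hx (.inr a)).diffFieldAt
    (c.smoothFieldAt_frame (ε := ε) hx (.inr b)).diffFieldAt
    (c.eventually_η_frame hx a) (c.eventually_η_frame hx b)
  rw [kaehler, h, neg_neg]

/-- The closedness of `ω = dη` on the horizontal frame. It comes from the Jacobi identity, since
`η` is constant on the frame and on its brackets. -/
lemma kaehler_mlieBracket_cyclic (hx : x ∈ c.U) (hε : ε ≠ 0) (a b d : Fin 3 ⊕ Fin 3) :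
    S.kaehler x (VectorField.mlieBracket (𝓡 7) (c.frame ε (.inr a)) (c.frame ε (.inr b)) x)
        (c.frame ε (.inr d) x)
      + S.kaehler x (VectorField.mlieBracket (𝓡 7) (c.frame ε (.inr b)) (c.frame ε (.inr d)) x)
        (c.frame ε (.inr a) x)
      + S.kaehler x (VectorField.mlieBracket (𝓡 7) (c.frame ε (.inr d)) (c.frame ε (.inr a)) x)
        (c.frame ε (.inr b) x) = 0 := by
  have sm : ∀ a, SmoothFieldAt (c.frame ε (.inr a)) x := fun a => c.smoothFieldAt_frame hx _
  have key : ∀ a b d : Fin 3 ⊕ Fin 3,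
      S.kaehler x (VectorField.mlieBracket (𝓡 7) (c.frame ε (.inr a)) (c.frame ε (.inr b)) x)
        (c.frame ε (.inr d) x)
      = - S.η x (VectorField.mlieBracket (𝓡 7)
          (VectorField.mlieBracket (𝓡 7) (c.frame ε (.inr a)) (c.frame ε (.inr b)))
          (c.frame ε (.inr d)) x) := by
    intro a b d
    refine mextDeriv_oneForm_apply_of_const (S.smooth_η.mono (Set.subset_univ c.U)) c.isOpen_U hx
      ((sm a).mlieBracket (sm b)).diffFieldAt (sm d).diffFieldAt
      (r := sgn b * (if Sum.inr b.swap = (Sum.inr a : Idx) then 1 else 0)) ?_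
      (c.eventually_η_frame hx d)
    filter_upwards [c.isOpen_U.mem_nhds hx] with y hy
    rw [c.η_mlieBracket_frame hy, c.kaehler_frame hy hε, neg_neg, c.coframe_frame hy hε]
  rw [key, key, key]
  have h2 : minSmoothness ℝ 2 ≤ ∞ := by
    rw [minSmoothness_of_isRCLikeNormedField]; exact ENat.LEInfty.out
  have : IsManifold (𝓡 7) (minSmoothness ℝ 3) K :=
    IsManifold.of_le (n := ∞) (by rw [minSmoothness_of_isRCLikeNormedField]; exact ENat.LEInfty.out)
  have jac := VectorField.leibniz_identity_mlieBracket_apply (I := 𝓡 7) (x := x)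
    (U := c.frame ε (.inr a)) (V := c.frame ε (.inr b)) (W := c.frame ε (.inr d))
    (ContMDiffAt.of_le (sm a) h2) (ContMDiffAt.of_le (sm b) h2) (ContMDiffAt.of_le (sm d) h2)
  have j2 := congrArg (S.η x) jac
  rw [map_add] at j2
  have s1 := congrArg (S.η x) (VectorField.mlieBracket_swap_apply (I := 𝓡 7) (x := x)
    (V := VectorField.mlieBracket (𝓡 7) (c.frame ε (.inr b)) (c.frame ε (.inr d)))
    (W := c.frame ε (.inr a)))
  have s2 := congrArg (S.η x) (VectorField.mlieBracket_swap_apply (I := 𝓡 7) (x := x)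
    (V := VectorField.mlieBracket (𝓡 7) (c.frame ε (.inr d)) (c.frame ε (.inr a)))
    (W := c.frame ε (.inr b)))
  rw [map_neg] at s1 s2
  have s3 : VectorField.mlieBracket (𝓡 7) (c.frame ε (.inr b))
      (VectorField.mlieBracket (𝓡 7) (c.frame ε (.inr a)) (c.frame ε (.inr d))) x
      = - VectorField.mlieBracket (𝓡 7) (c.frame ε (.inr b))
        (VectorField.mlieBracket (𝓡 7) (c.frame ε (.inr d)) (c.frame ε (.inr a))) x := by
    have h := VectorField.mlieBracket_const_smul_right (I := 𝓡 7) (x := x) (c := (-1 : ℝ))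
      (V := c.frame ε (.inr b)) ((sm d).mlieBracket (sm a)).diffFieldAt
    rw [neg_one_smul, neg_one_smul] at h
    rw [← h, ← VectorField.mlieBracket_swap]
  rw [s3, map_neg] at j2
  linarith

end Coframe

end ContactCalabiYau

end Structure

/-! ### The transverse Levi-Civita connection has holonomy in `SU(3)` -/

section LeviCivita

variable {K : Type*} [TopologicalSpace K] [ChartedSpace E7 K] [IsManifold (𝓡 7) ∞ K]

namespace ContactCalabiYau

variable {S : ContactCalabiYau K}

namespace Coframe

variable (c : S.Coframe) {x : K} {ε : ℝ} {A : TangentConnection K}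

lemma gV_frame_right (hx : x ∈ c.U) (hε : ε ≠ 0) (v : TangentSpace (𝓡 7) x) (b : Fin 3 ⊕ Fin 3) :
    S.gV x v (c.frame ε (.inr b) x) = c.coframe ε (.inr b) x v := by
  have h1 := c.coframe_frame hx hε
  rw [c.gV_eq hx]
  have h2 : ∀ i, c.e i x (c.frame ε (.inr b) x) = if (Sum.inl i) = b then 1 else 0 := by
    intro i; simpa [coframe] using h1 (.inr (.inl i)) (.inr b)
  have h3 : ∀ i, c.Je i x (c.frame ε (.inr b) x) = if (Sum.inr i) = b then 1 else 0 := by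
    intro i; simpa [coframe] using h1 (.inr (.inr i)) (.inr b)
  rcases b with i | i <;> simp [h2, h3, coframe]

lemma gV_frame_left (hx : x ∈ c.U) (hε : ε ≠ 0) (v : TangentSpace (𝓡 7) x) (b : Fin 3 ⊕ Fin 3) :
    S.gV x (c.frame ε (.inr b) x) v = c.coframe ε (.inr b) x v := by
  rw [← c.gV_frame_right hx hε, c.gV_eq hx, c.gV_eq hx]
  exact Finset.sum_congr rfl fun i _ => by ring

lemma connMatrix_inl_left (hA : S.IsTransverseLeviCivita A) (hx : x ∈ c.U) (u : Unit) (b : Idx) :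
    c.connMatrix ε A x (.inl u) b = 0 := by
  ext v
  rcases b with t | b
  · have h : A (c.frame ε (.inl t)) x = ε⁻¹ • A S.ξ x :=
      A.isCovariantDerivativeOnUniv.smul_const ε⁻¹ (S.smooth_ξ x).diffFieldAt
    simp [connMatrix, h, hA.parallel_ξ]
  · have h := hA.horizontal _ x (c.smoothFieldAt_frame (ε := ε) hx (.inr b)).diffFieldAt
      (c.eventually_η_frame hx b) v
    simp [connMatrix, coframe, h]

lemma connMatrix_inl_right (hA : S.IsTransverseLeviCivita A) (a : Idx) (u : Unit) :
    c.connMatrix ε A x a (.inl u) = 0 := by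
  ext v
  have h : A (c.frame ε (.inl u)) x = ε⁻¹ • A S.ξ x :=
    A.isCovariantDerivativeOnUniv.smul_const ε⁻¹ (S.smooth_ξ x).diffFieldAt
  simp [connMatrix, h, hA.parallel_ξ]

lemma connMatrix_skew (hA : S.IsTransverseLeviCivita A) (hx : x ∈ c.U) (hε : ε ≠ 0)
    (a b : Fin 3 ⊕ Fin 3) (v : TangentSpace (𝓡 7) x) :
    c.connMatrix ε A x (.inr a) (.inr b) v = - c.connMatrix ε A x (.inr b) (.inr a) v := by
  have h := hA.metric (c.frame ε (.inr a)) (c.frame ε (.inr b)) x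
    (c.smoothFieldAt_frame hx _).diffFieldAt (c.smoothFieldAt_frame hx _).diffFieldAt
    (c.eventually_η_frame hx a) (c.eventually_η_frame hx b) v
  rw [(hasMFDerivAt_zero_of_eventually_const
    (a := if (Sum.inr b : Idx) = Sum.inr a then (1 : ℝ) else 0) ?_).mfderiv] at h
  · have h1 : (0 : ℝ) = S.gV x (A (c.frame ε (.inr a)) x v) (c.frame ε (.inr b) x)
      + S.gV x (c.frame ε (.inr a) x) (A (c.frame ε (.inr b)) x v) := h
    rw [c.gV_frame_right hx hε, c.gV_frame_left hx hε] at h1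
    simp only [connMatrix, ContinuousLinearMap.comp_apply]
    linarith
  · filter_upwards [c.isOpen_U.mem_nhds hx] with y hy
    rw [c.gV_frame_right hy hε, c.coframe_frame hy hε]

/-- The horizontal connection coefficients are determined by the Lie brackets of the frame. -/
lemma connMatrix_sub_connMatrix (hA : S.IsTransverseLeviCivita A) (hx : x ∈ c.U)
    (a b d : Fin 3 ⊕ Fin 3) :
    c.connMatrix ε A x (.inr d) (.inr b) (c.frame ε (.inr a) x)
        - c.connMatrix ε A x (.inr d) (.inr a) (c.frame ε (.inr b) x)
      = c.coframe ε (.inr d) x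
        (VectorField.mlieBracket (𝓡 7) (c.frame ε (.inr a)) (c.frame ε (.inr b)) x) := by
  have h := hA.torsion_free (c.frame ε (.inr a)) (c.frame ε (.inr b)) x
    (c.smoothFieldAt_frame hx _).diffFieldAt (c.smoothFieldAt_frame hx _).diffFieldAt
    (c.eventually_η_frame hx a) (c.eventually_η_frame hx b)
  have h2 := congrArg (c.coframe ε (.inr d) x) h
  rw [map_sub, map_sub, map_smul, c.coframe_ξ hx, smul_zero, sub_zero] at h2
  exact h2

/-- The coframe is basic, so the transverse Levi-Civita connection has no vertical component. -/
lemma connMatrix_ξ (hA : S.IsTransverseLeviCivita A) (hx : x ∈ c.U) (hε : ε ≠ 0) (a b : Idx) :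
    c.connMatrix ε A x a b (S.ξ x) = 0 := by
  rcases a with u | a
  · rw [c.connMatrix_inl_left hA hx]; rfl
  rcases b with u | b
  · rw [c.connMatrix_inl_right hA]; rfl
  have h := hA.vertical (c.frame ε (.inr b)) x (c.smoothFieldAt_frame hx _).diffFieldAt
    (c.eventually_η_frame hx b)
  have h2 := congrArg (c.coframe ε (.inr a) x) h
  rw [map_sub, map_smul, c.coframe_ξ hx, smul_zero, sub_zero] at h2
  have h3 := mextDeriv_oneForm_apply_of_const (c.smooth_coframe (ε := ε) (.inr a)) c.isOpen_U hx
    (S.smooth_ξ x).diffFieldAt (c.smoothFieldAt_frame (ε := ε) hx (.inr b)).diffFieldAt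
    (r := 0) (by filter_upwards [c.isOpen_U.mem_nhds hx] with y hy; exact c.coframe_ξ hy a)
    (c.eventually_coframe_frame hx hε (.inr a) (.inr b))
  have h4 : mextDeriv (oneForm (c.coframe ε (.inr a))) x ![S.ξ x, c.frame ε (.inr b) x] = 0 := by
    rcases a with i | i
    · exact c.basic_e i x hx _
    · exact c.basic_Je i x hx _
  rw [h4] at h3
  refine h2.trans ?_
  linarith

/-- The vanishing of the Nijenhuis tensor on the horizontal frame. -/
lemma nijenhuis_frame (hx : x ∈ c.U) {β : Fin 3 ⊕ Fin 3 → Fin 3 ⊕ Fin 3 → Fin 3 ⊕ Fin 3 → ℝ}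
    (hβ : ∀ a b d, β a b d = c.coframe ε (.inr d) x
      (VectorField.mlieBracket (𝓡 7) (c.frame ε (.inr a)) (c.frame ε (.inr b)) x))
    (a b d : Fin 3 ⊕ Fin 3) :
    - β b d a + sgn b * sgn d * β b.swap d.swap a
      + sgn a * sgn b * β b.swap d a.swap + sgn a * sgn d * β b d.swap a.swap = 0 := by
  have sm : ∀ a, SmoothFieldAt (c.frame ε (.inr a)) x := fun a => c.smoothFieldAt_frame hx _
  have hJ : ∀ b : Fin 3 ⊕ Fin 3, (fun y => S.J y (c.frame ε (.inr b) y))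
      =ᶠ[𝓝 x] sgn b • c.frame ε (.inr b.swap) := by
    intro b
    filter_upwards [c.isOpen_U.mem_nhds hx] with y hy
    exact c.J_frame hy b
  have hE : ∀ b : Fin 3 ⊕ Fin 3, c.frame ε (.inr b) =ᶠ[𝓝 x] c.frame ε (.inr b) := fun b => .rfl
  have h := congrArg (c.coframe ε (.inr a) x) (S.normal _ _ x (sm b) (sm d))
  have e1 : VectorField.mlieBracket (𝓡 7) (fun y => S.J y (c.frame ε (.inr b) y))
      (fun y => S.J y (c.frame ε (.inr d) y)) x
      = sgn b • sgn d • VectorField.mlieBracket (𝓡 7) (c.frame ε (.inr b.swap))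
        (c.frame ε (.inr d.swap)) x := by
    rw [(hJ b).mlieBracket_vectorField_eq (hJ d),
      VectorField.mlieBracket_const_smul_left (sm _).diffFieldAt,
      VectorField.mlieBracket_const_smul_right (sm _).diffFieldAt]
  have e2 : VectorField.mlieBracket (𝓡 7) (fun y => S.J y (c.frame ε (.inr b) y))
      (c.frame ε (.inr d)) x
      = sgn b • VectorField.mlieBracket (𝓡 7) (c.frame ε (.inr b.swap))
        (c.frame ε (.inr d)) x := by
    rw [(hJ b).mlieBracket_vectorField_eq (hE d),
      VectorField.mlieBracket_const_smul_left (sm _).diffFieldAt]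
  have e3 : VectorField.mlieBracket (𝓡 7) (c.frame ε (.inr b))
      (fun y => S.J y (c.frame ε (.inr d) y)) x
      = sgn d • VectorField.mlieBracket (𝓡 7) (c.frame ε (.inr b))
        (c.frame ε (.inr d.swap)) x := by
    rw [(hE b).mlieBracket_vectorField_eq (hJ d),
      VectorField.mlieBracket_const_smul_right (sm _).diffFieldAt]
  rw [e1, e2, e3, S.J_sq] at h
  simp only [map_add, map_sub, map_neg, map_smul, smul_eq_mul, c.coframe_J hx, c.coframe_ξ hx,
    mul_zero, map_zero, add_zero] at h
  simp only [hβ]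
  linarith

/-- The transverse Levi-Civita connection commutes with `J`. -/
lemma connMatrix_J_frame (hA : S.IsTransverseLeviCivita A) (hx : x ∈ c.U) (hε : ε ≠ 0)
    (a b d : Fin 3 ⊕ Fin 3) :
    sgn b * c.connMatrix ε A x (.inr a) (.inr b.swap) (c.frame ε (.inr d) x)
      + sgn a * c.connMatrix ε A x (.inr a.swap) (.inr b) (c.frame ε (.inr d) x) = 0 := by
  refine unitary_of_kaehler_of_integrable
    (G := fun a b d => c.connMatrix ε A x (.inr a) (.inr b) (c.frame ε (.inr d) x))
    (β := fun a b d => c.coframe ε (.inr d) x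
        (VectorField.mlieBracket (𝓡 7) (c.frame ε (.inr a)) (c.frame ε (.inr b)) x))
    (fun a b d => c.connMatrix_skew hA hx hε a b _)
    (fun a b d => (c.connMatrix_sub_connMatrix hA hx a b d).symm) (fun a b d => ?_)
    (fun a b d => c.nijenhuis_frame hx (fun _ _ _ => rfl) a b d) a b d
  have h := c.kaehler_mlieBracket_cyclic hx hε a b d
  simp only [c.kaehler_frame hx hε] at h
  linarith

lemma connMatrix_apply (hA : S.IsTransverseLeviCivita A) (hx : x ∈ c.U) (hε : ε ≠ 0) (a b : Idx)
    (v : TangentSpace (𝓡 7) x) :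
    c.connMatrix ε A x a b v = ∑ d : Fin 3 ⊕ Fin 3,
      c.coframe ε (.inr d) x v * c.connMatrix ε A x a b (c.frame ε (.inr d) x) := by
  conv_lhs => rw [c.sum_coframe_smul_frame hx hε v]
  rw [map_sum, Fintype.sum_sum_type]
  simp [frame, c.connMatrix_ξ hA hx hε]

lemma connMatrix_J (hA : S.IsTransverseLeviCivita A) (hx : x ∈ c.U) (hε : ε ≠ 0)
    (a b : Fin 3 ⊕ Fin 3) (v : TangentSpace (𝓡 7) x) :
    sgn b * c.connMatrix ε A x (.inr a) (.inr b.swap) v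
      + sgn a * c.connMatrix ε A x (.inr a.swap) (.inr b) v = 0 := by
  rw [c.connMatrix_apply hA hx hε, c.connMatrix_apply hA hx hε (.inr a.swap), Finset.mul_sum,
    Finset.mul_sum, ← Finset.sum_add_distrib]
  refine Finset.sum_eq_zero fun d _ => ?_
  linear_combination c.coframe ε (.inr d) x v * c.connMatrix_J_frame hA hx hε a b d

/-- The connection induced by `A` on the transverse canonical bundle is flat: `dΩ = 0` and
`Ω ≠ 0` force the complex trace of the connection matrix to vanish. -/
lemma sum_connMatrix_frame (hA : S.IsTransverseLeviCivita A) (hx : x ∈ c.U) (hε : ε ≠ 0)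
    (d : Fin 3 ⊕ Fin 3) :
    ∑ i : Fin 3, c.connMatrix ε A x (.inr (.inr i)) (.inr (.inl i)) (c.frame ε (.inr d) x) = 0 := by
  have sm : ∀ a, SmoothFieldAt (c.frame ε (.inr a)) x := fun a => c.smoothFieldAt_frame hx _
  have he : ∀ i, ∀ y ∈ c.U, ∀ b : Fin 3 ⊕ Fin 3,
      c.e i y (c.frame ε (.inr b) y) = if (Sum.inl i) = b then 1 else 0 := by
    intro i y hy b; simpa [coframe] using c.coframe_frame hy hε (.inr (.inl i)) (.inr b)
  have hJe : ∀ i, ∀ y ∈ c.U, ∀ b : Fin 3 ⊕ Fin 3,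
      c.Je i y (c.frame ε (.inr b) y) = if (Sum.inr i) = b then 1 else 0 := by
    intro i y hy b; simpa [coframe] using c.coframe_frame hy hε (.inr (.inr i)) (.inr b)
  -- `dΩ(Ju_l, u₁, u₂, u₃) = 0`, whose real and imaginary parts contain the trace in the
  -- directions `u_l` and `Ju_l`
  have hΩ : ∀ l : Fin 3, _ := fun l => mextDeriv_threeForm_apply
    (S.smooth_Ω.mono (Set.subset_univ c.U)) c.isOpen_U hx
    (X := fun n => c.frame ε (.inr ((![.inr l, .inl 0, .inl 1, .inl 2] :
      Fin 4 → Fin 3 ⊕ Fin 3) n))) (fun n => (sm _).diffFieldAt) (by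
      intro n₁ n₂ n₃
      generalize (![.inr l, .inl 0, .inl 1, .inl 2] : Fin 4 → Fin 3 ⊕ Fin 3) = n
      refine ⟨S.Ω x ![c.frame ε (.inr (n n₁)) x, c.frame ε (.inr (n n₂)) x,
        c.frame ε (.inr (n n₃)) x], ?_⟩
      filter_upwards [c.isOpen_U.mem_nhds hx] with y hy
      rw [c.Ω_eq x hx, c.Ω_eq y hy]
      congr 1
      ext i m
      fin_cases m <;> simp [he i y hy, hJe i y hy, he i x hx, hJe i x hx])
  simp only [S.Ω_closed] at hΩ
  simp [c.Ω_eq x hx, Matrix.det_fin_three, he _ x hx, hJe _ x hx] at hΩ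
  -- the coefficients are made opaque, to be treated as unknowns of a linear system
  obtain ⟨G, hGdef⟩ : ∃ G : Fin 3 ⊕ Fin 3 → Fin 3 ⊕ Fin 3 → Fin 3 ⊕ Fin 3 → ℝ, ∀ a b d,
      G a b d = c.connMatrix ε A x (.inr a) (.inr b) (c.frame ε (.inr d) x) :=
    ⟨_, fun _ _ _ => rfl⟩
  have hβ : ∀ a b d, G d b a - G d a b = c.coframe ε (.inr d) x
      (VectorField.mlieBracket (𝓡 7) (c.frame ε (.inr a)) (c.frame ε (.inr b)) x) := by
    intro a b d
    rw [hGdef, hGdef]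
    exact c.connMatrix_sub_connMatrix hA hx a b d
  have hβe : ∀ i a b, c.e i x (VectorField.mlieBracket (𝓡 7) (c.frame ε (.inr a))
      (c.frame ε (.inr b)) x) = G (.inl i) b a - G (.inl i) a b :=
    fun i a b => (hβ a b (.inl i)).symm
  have hβJe : ∀ i a b, c.Je i x (VectorField.mlieBracket (𝓡 7) (c.frame ε (.inr a))
      (c.frame ε (.inr b)) x) = G (.inr i) b a - G (.inr i) a b :=
    fun i a b => (hβ a b (.inr i)).symm
  have hskew : ∀ a b d, G a b d = - G b a d := fun a b d => by
    rw [hGdef, hGdef]; exact c.connMatrix_skew hA hx hε a b _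
  have hJ : ∀ a b d, sgn b * G a b.swap d + sgn a * G a.swap b d = 0 := fun a b d => by
    rw [hGdef, hGdef]; exact c.connMatrix_J_frame hA hx hε a b d
  have hlr : ∀ i j d, G (.inl i) (.inr j) d = - G (.inr i) (.inl j) d := fun i j d => by
    have := hJ (.inl i) (.inl j) d
    simp [sgn] at this
    linarith
  have hrr : ∀ i j d, G (.inr i) (.inr j) d = G (.inl i) (.inl j) d := fun i j d => by
    have := hJ (.inl i) (.inr j) d
    simp [sgn] at this
    linarith
  have hsymm : ∀ i j d, G (.inr i) (.inl j) d = G (.inr j) (.inl i) d := fun i j d => by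
    rw [hskew, hlr, neg_neg]
  have hdiag : ∀ i d, G (.inl i) (.inl i) d = 0 := fun i d => by
    linarith [hskew (.inl i) (.inl i) d]
  simp only [← hGdef, Fin.sum_univ_three]
  have h0 := hΩ 0
  have h1 := hΩ 1
  have h2 := hΩ 2
  simp [Complex.ext_iff] at h0 h1 h2
  simp only [hβe, hβJe, hlr, hrr, hdiag, hskew (.inl 1) (.inl 0), hskew (.inl 2) (.inl 0),
    hskew (.inl 2) (.inl 1), hsymm 1 0, hsymm 2 0, hsymm 2 1] at h0 h1 h2
  obtain ⟨h0, h0'⟩ := h0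
  obtain ⟨h1, h1'⟩ := h1
  obtain ⟨h2, h2'⟩ := h2
  rcases d with l | l <;> fin_cases l <;> simp only [Fin.zero_eta, Fin.mk_one, Fin.reduceFinMk] <;>
    linarith

lemma sum_connMatrix (hA : S.IsTransverseLeviCivita A) (hx : x ∈ c.U) (hε : ε ≠ 0)
    (v : TangentSpace (𝓡 7) x) :
    ∑ i : Fin 3, c.connMatrix ε A x (.inr (.inr i)) (.inr (.inl i)) v = 0 := by
  simp only [c.connMatrix_apply hA hx hε _ _ v]
  rw [Finset.sum_comm]
  refine Finset.sum_eq_zero fun d _ => ?_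
  rw [← Finset.mul_sum, c.sum_connMatrix_frame hA hx hε, mul_zero]

/-- The connection coefficients are differentiable: Koszul's formula expresses them by the
components of the Lie brackets of the frame. -/
lemma mdifferentiableAt_connMatrix_frame (hA : S.IsTransverseLeviCivita A) (hx : x ∈ c.U)
    (hε : ε ≠ 0) (a b d : Fin 3 ⊕ Fin 3) :
    MDifferentiableAt (𝓡 7) 𝓘(ℝ, ℝ)
      (fun y => c.connMatrix ε A y (.inr a) (.inr b) (c.frame ε (.inr d) y)) x := by
  have hd : ∀ a b d : Fin 3 ⊕ Fin 3, MDifferentiableAt (𝓡 7) 𝓘(ℝ, ℝ)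
      (fun y => c.coframe ε (.inr d) y
        (VectorField.mlieBracket (𝓡 7) (c.frame ε (.inr a)) (c.frame ε (.inr b)) y)) x :=
    fun a b d => c.mdifferentiableAt_coframe hx _
      ((c.smoothFieldAt_frame hx _).mlieBracket (c.smoothFieldAt_frame hx _)).diffFieldAt
  have h := ((hd d b a).sub ((hd d a b).add (hd b a d))).const_smul (1 / 2 : ℝ)
  refine h.congr_of_eventuallyEq ?_
  filter_upwards [c.isOpen_U.mem_nhds hx] with y hy
  have hs := fun a b d => c.connMatrix_skew hA hy hε a b (c.frame ε (.inr d) y)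
  have ht := c.connMatrix_sub_connMatrix (ε := ε) hA hy
  simp only [Pi.smul_apply, Pi.sub_apply, Pi.add_apply, ← ht, smul_eq_mul]
  linarith [hs a b d, hs a d b, hs b d a]

lemma mdifferentiableAt_connMatrix (hA : S.IsTransverseLeviCivita A) (hx : x ∈ c.U) (hε : ε ≠ 0)
    {X : ∀ y : K, TangentSpace (𝓡 7) y} (hX : DiffFieldAt X x) (a b : Idx) :
    MDifferentiableAt (𝓡 7) 𝓘(ℝ, ℝ) (fun y => c.connMatrix ε A y a b (X y)) x := by
  have h0 : (∀ y ∈ c.U, c.connMatrix ε A y a b = 0) → MDifferentiableAt (𝓡 7) 𝓘(ℝ, ℝ)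
      (fun y => c.connMatrix ε A y a b (X y)) x := fun h =>
    (hasMFDerivAt_zero_of_eventually_const (a := (0 : ℝ)) (by
      filter_upwards [c.isOpen_U.mem_nhds hx] with y hy
      rw [h y hy]; rfl)).mdifferentiableAt
  rcases a with u | a
  · exact h0 fun y hy => c.connMatrix_inl_left hA hy u b
  rcases b with u | b
  · exact h0 fun y hy => c.connMatrix_inl_right hA _ u
  have h := MDifferentiableAt.sum (t := Finset.univ) fun (d : Fin 3 ⊕ Fin 3) _ =>
    (c.mdifferentiableAt_coframe (ε := ε) hx (.inr d) hX).smul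
      (c.mdifferentiableAt_connMatrix_frame hA hx hε a b d)
  refine h.congr_of_eventuallyEq ?_
  filter_upwards [c.isOpen_U.mem_nhds hx] with y hy
  rw [c.connMatrix_apply hA hy hε, Finset.sum_apply]
  rfl

end Coframe

end ContactCalabiYau

end LeviCivita

/-! ### Algebra of the matrix `B + δ C + m e₀ 𝓘` -/

section Algebra

/-- The matrix `B + δ C + m e₀ 𝓘`, evaluated on a vector with components `w` in the coframe
`(e₀, e, Je)`. -/
def bismutMatrix (δ m : ℝ) (w : Idx → ℝ) : Matrix Idx Idx ℝ :=
  block ((1 + δ) • fun i => w (.inr (.inr i))) (-((1 + δ) • fun i => w (.inr (.inl i))))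
    (-((1 + δ) • fun i => w (.inr (.inr i)))) ((1 + δ) • fun i => w (.inr (.inl i)))
    (-(δ • box fun i => w (.inr (.inl i))))
    (δ • box (fun i => w (.inr (.inr i))) - ((1 - δ + m) * w (.inl ())) • 1)
    (δ • box (fun i => w (.inr (.inr i))) + ((1 - δ + m) * w (.inl ())) • 1)
    (δ • box fun i => w (.inr (.inl i)))

lemma bismutMatrix_add (δ m : ℝ) (w w' : Idx → ℝ) :
    bismutMatrix δ m (w + w') = bismutMatrix δ m w + bismutMatrix δ m w' := by
  ext (_ | i | i) (_ | j | j) <;> (try fin_cases i) <;> (try fin_cases j) <;>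
    simp [bismutMatrix, block, box] <;> ring

lemma bismutMatrix_smul (δ m r : ℝ) (w : Idx → ℝ) :
    bismutMatrix δ m (r • w) = r • bismutMatrix δ m w := by
  ext (_ | i | i) (_ | j | j) <;> (try fin_cases i) <;> (try fin_cases j) <;>
    simp [bismutMatrix, block, box] <;> ring

/-- `bismutMatrix` as a linear map. -/
def bismutMatrixₗ (δ m : ℝ) : (Idx → ℝ) →ₗ[ℝ] Matrix Idx Idx ℝ where
  toFun := bismutMatrix δ m
  map_add' := bismutMatrix_add δ m
  map_smul' := bismutMatrix_smul δ m

lemma bismutMatrixₗ_apply (δ m : ℝ) (w : Idx → ℝ) :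
    bismutMatrixₗ δ m w = bismutMatrix δ m w := rfl

section

variable {V : Type*} [AddCommGroup V] [Module ℝ V] [TopologicalSpace V]

lemma wedge₁₁_apply (α β : V →L[ℝ] ℝ) (X Y : V) :
    wedge₁₁ α β X Y = α X * β Y - β X * α Y := rfl

variable (δ : ℝ) (X Y : V)

lemma crossWedge_apply (a b : Fin 3 → V →L[ℝ] ℝ) (i : Fin 3) :
    crossWedge a b i X Y = ![a 1 X * b 2 Y - b 2 X * a 1 Y - (a 2 X * b 1 Y - b 1 X * a 2 Y),
      a 2 X * b 0 Y - b 0 X * a 2 Y - (a 0 X * b 2 Y - b 2 X * a 0 Y),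
      a 0 X * b 1 Y - b 1 X * a 0 Y - (a 1 X * b 0 Y - b 0 X * a 1 Y)] i := by
  fin_cases i <;> rfl

lemma matQminus_apply (e₀ : V →L[ℝ] ℝ) (e Je : Fin 3 → (V →L[ℝ] ℝ)) (i j : Idx) :
    matQminus δ e₀ e Je i j X Y
      = e₀ X * block ((1 + δ) • fun i => e i Y) ((1 + δ) • fun i => Je i Y)
          (-((1 + δ) • fun i => e i Y)) (-((1 + δ) • fun i => Je i Y))
          ((-2 * δ) • box fun i => Je i Y) ((-2 * δ) • box fun i => e i Y)
          ((-2 * δ) • box fun i => e i Y) ((2 * δ) • box fun i => Je i Y) i j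
        - block ((1 + δ) • fun i => e i X) ((1 + δ) • fun i => Je i X)
          (-((1 + δ) • fun i => e i X)) (-((1 + δ) • fun i => Je i X))
          ((-2 * δ) • box fun i => Je i X) ((-2 * δ) • box fun i => e i X)
          ((-2 * δ) • box fun i => e i X) ((2 * δ) • box fun i => Je i X) i j * e₀ Y := by
  have h : ∀ (a : Fin 3 → V →L[ℝ] ℝ) (i j : Fin 3) (Z : V),
      box a i j Z = box (fun i => a i Z) i j := by
    intro a i j Z
    fin_cases i <;> fin_cases j <;> rfl
  rcases i with _ | i | i <;> rcases j with _ | j | j <;>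
    simp only [matQminus, Matrix.map_apply, block, wedge₁₁_apply, Matrix.smul_apply,
      Pi.smul_apply, Pi.neg_apply, _root_.smul_apply, _root_.neg_apply, _root_.zero_apply, h]

lemma box_apply_apply (a : Fin 3 → V →L[ℝ] V →L[ℝ] ℝ) (i j : Fin 3) :
    box a i j X Y = box (fun i => a i X Y) i j := by
  fin_cases i <;> fin_cases j <;> rfl

lemma matQplus_apply (e Je : Fin 3 → (V →L[ℝ] ℝ)) (i j : Idx) :
    matQplus δ e Je i j X Y
      = block ((2 * δ) • fun i => crossWedge e Je i X Y)
          (δ • fun i => crossWedge e e i X Y - crossWedge Je Je i X Y)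
          (-((2 * δ) • fun i => crossWedge e Je i X Y))
          (-(δ • fun i => crossWedge e e i X Y - crossWedge Je Je i X Y))
          (-((1 + δ) • fun i j => Je i X * Je j Y - Je j X * Je i Y))
          ((1 + δ) • fun i j => Je i X * e j Y - e j X * Je i Y)
          ((1 + δ) • fun i j => e i X * Je j Y - Je j X * e i Y)
          (-((1 + δ) • fun i j => e i X * e j Y - e j X * e i Y)) i j := by
  rcases i with _ | i | i <;> rcases j with _ | j | j <;> rfl

lemma matWedge_box_apply (a b : Fin 3 → V →L[ℝ] ℝ) (i j : Fin 3) :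
    matWedge (box a) (box b) i j X Y
      = (box (fun i => a i X) * box fun i => b i Y) i j
        - (box (fun i => b i X) * box fun i => a i Y) j i := by
  simp only [matWedge, Matrix.mul_apply, Fin.sum_univ_three, _root_.add_apply, wedge₁₁_apply]
  fin_cases i <;> fin_cases j <;> simp [box] <;> ring

lemma matQzero_apply (e Je : Fin 3 → (V →L[ℝ] ℝ)) (i j : Idx) :
    matQzero e Je i j X Y
      = (1 / 2 : ℝ) * block 0 0 0 0
          (-box fun i => crossWedge e e i X Y + crossWedge Je Je i X Y)
          ((-2 : ℝ) • fun i j => matWedge (box e) (box Je) i j X Y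
            - matWedge (box Je) (box e) i j X Y)
          ((2 : ℝ) • fun i j => matWedge (box e) (box Je) i j X Y
            - matWedge (box Je) (box e) i j X Y)
          (-box fun i => crossWedge e e i X Y + crossWedge Je Je i X Y) i j := by
  have h : ∀ i j, box (crossWedge e e + crossWedge Je Je) i j X Y
      = box (fun i => crossWedge e e i X Y + crossWedge Je Je i X Y) i j := by
    intro i j
    rw [box_apply_apply]
    rfl
  rcases i with _ | i | i <;> rcases j with _ | j | j <;>
    first
    | rfl
    | (simp only [matQzero, Matrix.smul_apply, block, Matrix.neg_apply, _root_.smul_apply,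
        _root_.neg_apply, h]; rfl)

lemma matQ_apply (m : ℝ) (e₀ : V →L[ℝ] ℝ) (e Je : Fin 3 → (V →L[ℝ] ℝ)) (i j : Idx) :
    matQ δ m e₀ e Je i j X Y = (1 - δ + m) * matQminus δ e₀ e Je i j X Y
      + (1 + δ) * matQplus δ e Je i j X Y + δ ^ 2 * matQzero e Je i j X Y := rfl

set_option maxHeartbeats 3200000 in
/-- The commutator of `B + δ C + m e₀ 𝓘`, i.e. half of its wedge square, is `Q_m^δ`. -/
lemma bismutMatrix_commutator (m : ℝ) (α : Idx → V →L[ℝ] ℝ) :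
    bismutMatrix δ m (fun a => α a X) * bismutMatrix δ m (fun a => α a Y)
      - bismutMatrix δ m (fun a => α a Y) * bismutMatrix δ m (fun a => α a X)
    = (matQ δ m (α (.inl ())) (fun i => α (.inr (.inl i))) (fun i => α (.inr (.inr i)))).map
        (fun q => q X Y) := by
  ext i j
  rw [Matrix.map_apply, matQ_apply, matQminus_apply, matQplus_apply, matQzero_apply]
  simp only [crossWedge_apply, matWedge_box_apply]
  -- once evaluated on `X` and `Y`, both sides are polynomials in the components
  generalize hw : (fun a => α a X) = w
  generalize hw' : (fun a => α a Y) = w'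
  have hX : ∀ a, α a X = w a := fun a => congrFun hw a
  have hY : ∀ a, α a Y = w' a := fun a => congrFun hw' a
  simp only [hX, hY]
  clear hX hY hw hw'
  rcases i with _ | i | i <;> rcases j with _ | j | j <;>
    simp only [Matrix.sub_apply, Matrix.mul_apply, Fintype.sum_sum_type, Finset.univ_unique,
      Finset.sum_singleton, Fin.sum_univ_three, bismutMatrix, block] <;>
    (try fin_cases i) <;> (try fin_cases j) <;> simp [box] <;> ring

/-- `B + δ C + m e₀ 𝓘` as a combination of the blocks. -/
lemma bismutMatrix_eq (δ m : ℝ) (α : Idx → V →L[ℝ] ℝ) (v : V) (a b : Idx) :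
    bismutMatrix δ m (fun a => α a v) a b
      = matB (α (.inl ())) (fun i => α (.inr (.inl i))) (fun i => α (.inr (.inr i))) a b v
        + δ * matC (α (.inl ())) (fun i => α (.inr (.inl i))) (fun i => α (.inr (.inr i))) a b v
        + m * formSmul (α (.inl ())) matI a b v := by
  rcases a with _ | i | i <;> rcases b with _ | j | j <;>
    (try fin_cases i) <;> (try fin_cases j) <;>
    simp [bismutMatrix, block, box, matB, matC, formSmul, matI, scalarForm] <;> ring

end

set_option maxHeartbeats 3200000 in
/-- `B + δ C + m e₀ 𝓘` is invariant under `SU(3)`: its commutator with an element `Γ` of the Lie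
algebra `𝔰𝔲(3)` is its value on `Γ w`. -/
lemma commutator_bismutMatrix (δ m : ℝ) (Γ : Matrix Idx Idx ℝ) (w : Idx → ℝ)
    (hl : ∀ u b, Γ (.inl u) b = 0) (hr : ∀ a u, Γ a (.inl u) = 0)
    (hskew : ∀ a b, Γ a b = -Γ b a)
    (hJ : ∀ i j, Γ (.inr (.inr i)) (.inr (.inr j)) = Γ (.inr (.inl i)) (.inr (.inl j)))
    (hJ' : ∀ i j, Γ (.inr (.inl i)) (.inr (.inr j)) = -Γ (.inr (.inr i)) (.inr (.inl j)))
    (htr : ∑ i, Γ (.inr (.inr i)) (.inr (.inl i)) = 0) :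
    Γ * bismutMatrix δ m w - bismutMatrix δ m w * Γ = bismutMatrix δ m (Γ.mulVec w) := by
  -- `Γ` has the blocks `(P, -Q; Q, P)` with `P` skew and `Q` symmetric and trace-free
  have hP : ∀ i j, Γ (.inr (.inl i)) (.inr (.inl j)) = -Γ (.inr (.inl j)) (.inr (.inl i)) :=
    fun i j => hskew _ _
  have hQ : ∀ i j, Γ (.inr (.inr i)) (.inr (.inl j)) = Γ (.inr (.inr j)) (.inr (.inl i)) :=
    fun i j => by rw [hskew, hJ', neg_neg]
  have hP0 : ∀ i, Γ (.inr (.inl i)) (.inr (.inl i)) = 0 := fun i => by linarith [hP i i]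
  rw [Fin.sum_univ_three] at htr
  have hQ2 := eq_neg_of_add_eq_zero_right htr
  have h10 := hP 1 0
  have h20 := hP 2 0
  have h21 := hP 2 1
  have k10 := hQ 1 0
  have k20 := hQ 2 0
  have k21 := hQ 2 1
  ext a b
  rcases a with a | a | a <;> rcases b with b | b | b <;>
    simp only [Matrix.sub_apply, Matrix.mul_apply, Matrix.mulVec, dotProduct, Fintype.sum_sum_type,
      Finset.univ_unique, Finset.sum_singleton, Fin.sum_univ_three, bismutMatrix, block, hl, hr, hJ,
      hJ'] <;>
    (try fin_cases a) <;> (try fin_cases b) <;>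
    simp [box, hP0, h10, h20, h21, k10, k20, k21, hQ2] <;> ring

/-- The trilinear form of `B + δ C + m e₀ 𝓘` with all indices lowered. The part of `C` is the form
`-e₀ ∧ ω + Re Ω`. -/
lemma sum_bismutMatrix (δ m : ℝ) (v w z : Idx → ℝ) (σ : (Idx → ℝ) → (Idx → ℝ) → ℝ)
    (hσ : ∀ v w, σ v w = ∑ i, (v (.inr (.inl i)) * w (.inr (.inr i))
      - v (.inr (.inr i)) * w (.inr (.inl i)))) :
    ∑ a, (∑ b, bismutMatrix δ m v a b * w b) * z a
      = -(z (.inl ()) * σ v w) + w (.inl ()) * σ v z + (1 + m) * (v (.inl ()) * σ w z)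
        + δ * (-(v (.inl ()) * σ w z + w (.inl ()) * σ z v + z (.inl ()) * σ v w)
          + (Matrix.det (Matrix.of fun i j : Fin 3 =>
            ((![v, w, z] j (.inr (.inl i)) : ℂ)
              + Complex.I * (![v, w, z] j (.inr (.inr i)) : ℂ)))).re) := by
  simp only [hσ, Fintype.sum_sum_type, Finset.univ_unique, Finset.sum_singleton,
    Fin.sum_univ_three, bismutMatrix, block]
  simp [box, Matrix.det_fin_three]
  ring

/-- On the Reeb direction, `B + δ C + m e₀ 𝓘` is a multiple of the complex structure. -/
lemma bismutMatrix_inl (δ m r : ℝ) :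
    bismutMatrix δ m (Sum.elim (fun _ => r) 0) = ((1 - δ + m) * r) • matI := by
  ext a b
  rcases a with a | a | a <;> rcases b with b | b | b <;> (try fin_cases a) <;>
    (try fin_cases b) <;> simp [bismutMatrix, block, box, matI]

end Algebra

/-! ### Torsion and curvature of the twisted connection -/

section Torsion

variable {K : Type*} [TopologicalSpace K] [ChartedSpace E7 K]

lemma mdifferentiableAt_sum_mul_const {ι : Type*} (s : Finset ι) {f : ι → K → ℝ} {x : K}
    (hf : ∀ d, MDifferentiableAt (𝓡 7) 𝓘(ℝ, ℝ) (f d) x) (C : ι → ℝ) :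
    MDifferentiableAt (𝓡 7) 𝓘(ℝ, ℝ) (fun y => ∑ d ∈ s, f d y * C d) x ∧
    ∀ v, mvfderiv (𝓡 7) (fun y => ∑ d ∈ s, f d y * C d) x v
      = ∑ d ∈ s, mvfderiv (𝓡 7) (f d) x v * C d := by
  classical
  induction s using Finset.induction_on with
  | empty =>
    simp only [Finset.sum_empty]
    exact ⟨mdifferentiableAt_const, fun v => by rw [mvfderiv_const]; rfl⟩
  | insert i s hi ih =>
    simp only [Finset.sum_insert hi]
    have h1 : MDifferentiableAt (𝓡 7) 𝓘(ℝ, ℝ) (fun y => f i y * C i) x :=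
      (hf i).mul mdifferentiableAt_const
    refine ⟨h1.add ih.1, fun v => ?_⟩
    rw [mvfderiv_fun_add h1 ih.1, _root_.add_apply, ih.2,
      mvfderiv_fun_mul (hf i) mdifferentiableAt_const, mvfderiv_const]
    simp [mul_comm]

/-- The matrix `B + δ C + m e₀ 𝓘` is linear in the vector, so that it can be differentiated
componentwise. -/
lemma mdifferentiableAt_bismutMatrix (δ m : ℝ) {f : Idx → K → ℝ} {x : K}
    (hf : ∀ d, MDifferentiableAt (𝓡 7) 𝓘(ℝ, ℝ) (f d) x) (a b : Idx) :
    MDifferentiableAt (𝓡 7) 𝓘(ℝ, ℝ) (fun y => bismutMatrix δ m (fun d => f d y) a b) x ∧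
    ∀ v, mvfderiv (𝓡 7) (fun y => bismutMatrix δ m (fun d => f d y) a b) x v
      = bismutMatrix δ m (fun d => mvfderiv (𝓡 7) (f d) x v) a b := by
  have h : ∀ w : Idx → ℝ, bismutMatrix δ m w a b
      = ∑ d, w d * bismutMatrixₗ δ m (fun d' => if d = d' then 1 else 0) a b := by
    intro w
    rw [← bismutMatrixₗ_apply, LinearMap.pi_apply_eq_sum_univ, Matrix.sum_apply]
    rfl
  simp only [h]
  exact mdifferentiableAt_sum_mul_const _ hf _

variable [IsManifold (𝓡 7) ∞ K]

lemma exists_diffFieldAt {x : K} (v : TangentSpace (𝓡 7) x) :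
    ∃ X : ∀ y : K, TangentSpace (𝓡 7) y, DiffFieldAt X x ∧ X x = v :=
  ⟨FiberBundle.extend E7 v, FiberBundle.mdifferentiableAt_extend (𝓡 7) E7 v,
    FiberBundle.extend_apply_self E7 v⟩

namespace ContactCalabiYau

lemma flux_swap (S : ContactCalabiYau K) (ε : ℝ) (x : K) (u v w : TangentSpace (𝓡 7) x) :
    S.flux ε x v u w = - S.flux ε x u v w := by
  have h : S.Ω x ![v, u, w] = - S.Ω x ![u, v, w] := by
    have h := (S.Ω x).map_swap ![u, v, w] (i := 0) (j := 1) (by decide)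
    refine Eq.trans (congrArg (S.Ω x) ?_) h
    funext i
    fin_cases i <;> rfl
  simp only [flux, wedgeKaehler, h, Complex.neg_re]
  rw [S.kaehler_swap x v u, S.kaehler_swap x w v, S.kaehler_swap x u w]
  ring

variable {S : ContactCalabiYau K}

namespace Coframe

variable (c : S.Coframe) {x : K} {ε : ℝ} {A : TangentConnection K}

/-- Cartan's first structure equation: the components of the torsion in a coframe are `de + θ ∧ e`,
written out on two vector fields. -/
lemma coframe_torsion (hx : x ∈ c.U) (hε : ε ≠ 0) (D : TangentConnection K)
    {X Y : ∀ y : K, TangentSpace (𝓡 7) y} (hX : DiffFieldAt X x) (hY : DiffFieldAt Y x) (a : Idx) :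
    c.coframe ε a x (D.torsion x (X x) (Y x)) =
      mvfderiv (𝓡 7) (fun y => c.coframe ε a y (Y y)) x (X x)
        - mvfderiv (𝓡 7) (fun y => c.coframe ε a y (X y)) x (Y x)
        - c.coframe ε a x (VectorField.mlieBracket (𝓡 7) X Y x)
        + ∑ b, (c.connMatrix ε D x a b (X x) * c.coframe ε b x (Y x)
          - c.connMatrix ε D x a b (Y x) * c.coframe ε b x (X x)) := by
  rw [D.torsion_apply hX hY, map_sub, map_sub, c.coframe_covariantDerivative hx hε D hY,
    c.coframe_covariantDerivative hx hε D hX, Finset.sum_sub_distrib]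
  ring

/-- `A_ξ E_b - A_{E_b} ξ = A_ξ E_b` is the horizontal part of `[ξ, E_b]`, and `[ξ, E_b]` is
horizontal as `dη(ξ, ·) = 0`. -/
lemma torsion_ξ_frame (hA : S.IsTransverseLeviCivita A) (hx : x ∈ c.U) (b : Fin 3 ⊕ Fin 3) :
    A.torsion x (S.ξ x) (c.frame ε (.inr b) x) = 0 := by
  have hE := (c.smoothFieldAt_frame (ε := ε) hx (.inr b)).diffFieldAt
  have h := mextDeriv_oneForm_apply_of_const (S.smooth_η.mono (Set.subset_univ c.U)) c.isOpen_U hx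
    (S.smooth_ξ x).diffFieldAt hE (Filter.Eventually.of_forall S.η_ξ) (c.eventually_η_frame hx b)
  rw [S.reeb, eq_comm, neg_eq_zero] at h
  have h2 := hA.vertical _ x hE (c.eventually_η_frame hx b)
  rw [h, zero_smul, sub_zero] at h2
  rw [A.torsion_apply (S.smooth_ξ x).diffFieldAt hE, hA.parallel_ξ]
  rw [h2]
  simp

/-- The torsion of the transverse Levi-Civita connection is `ω ⊗ ξ`. -/
lemma torsion_transverseLeviCivita (hA : S.IsTransverseLeviCivita A) (hx : x ∈ c.U)
    (X Y : TangentSpace (𝓡 7) x) : A.torsion x X Y = S.kaehler x X Y • S.ξ x := by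
  have hreeb : ∀ v, S.kaehler x (S.ξ x) v = 0 := S.reeb x
  have key : ∀ a b : Idx, A.torsion x (c.frame 1 a x) (c.frame 1 b x)
      = S.kaehler x (c.frame 1 a x) (c.frame 1 b x) • S.ξ x := by
    have hξ : ∀ u, c.frame 1 (.inl u) x = S.ξ x := fun u => by simp [frame]
    rintro (u | a) (t | b)
    · rw [hξ, hreeb, zero_smul, A.torsion_self]
    · rw [hξ, hreeb, zero_smul, c.torsion_ξ_frame hA hx]
    · rw [hξ, S.kaehler_swap, hreeb, neg_zero, zero_smul, A.torsion_antisymm,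
        c.torsion_ξ_frame hA hx, neg_zero]
    · have hE := fun b => (c.smoothFieldAt_frame (ε := 1) hx (.inr b)).diffFieldAt
      rw [A.torsion_apply (hE a) (hE b), hA.torsion_free _ _ x (hE a) (hE b)
        (c.eventually_η_frame hx a) (c.eventually_η_frame hx b), c.η_mlieBracket_frame hx]
      simp
  have hω : ∀ v w, S.kaehler x v w = (∑ i, wedge₁₁ (c.e i x) (c.Je i x)) v w := fun v w => by
    rw [c.ω_eq x hx]; simp
  simp only [hω] at key ⊢
  rw [c.sum_coframe_smul_frame hx one_ne_zero X, c.sum_coframe_smul_frame hx one_ne_zero Y]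
  generalize (∑ i, wedge₁₁ (c.e i x) (c.Je i x)) = W at key
  simp only [map_sum, map_smul, _root_.sum_apply, _root_.smul_apply, key, Finset.sum_smul,
    Finset.smul_sum, smul_smul, smul_eq_mul, Finset.mul_sum]

/-- Cartan's first structure equation for the transverse Levi-Civita connection. -/
lemma structure_equation (hA : S.IsTransverseLeviCivita A) (hx : x ∈ c.U) (hε : ε ≠ 0)
    {X Y : ∀ y : K, TangentSpace (𝓡 7) y} (hX : DiffFieldAt X x) (hY : DiffFieldAt Y x) (a : Idx) :
    mvfderiv (𝓡 7) (fun y => c.coframe ε a y (Y y)) x (X x)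
        - mvfderiv (𝓡 7) (fun y => c.coframe ε a y (X y)) x (Y x)
        - c.coframe ε a x (VectorField.mlieBracket (𝓡 7) X Y x)
      = S.kaehler x (X x) (Y x) * c.coframe ε a x (S.ξ x)
        - ((c.connMatrix ε A x).map (fun θ => θ (X x))).mulVec (fun b => c.coframe ε b x (Y x)) a
        + ((c.connMatrix ε A x).map (fun θ => θ (Y x))).mulVec
          (fun b => c.coframe ε b x (X x)) a := by
  have h := c.coframe_torsion hx hε A hX hY a
  rw [c.torsion_transverseLeviCivita hA hx, map_smul, smul_eq_mul, Finset.sum_sub_distrib] at h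
  simp only [Matrix.mulVec, dotProduct, Matrix.map_apply]
  linarith

/-- The matrix `(kε/2) (B + δ C + m e₀ 𝓘)` by which the twisted connection differs from the
transverse Levi-Civita connection. -/
def twist (ε δ k m : ℝ) (x : K) : Matrix Idx Idx (TangentSpace (𝓡 7) x →L[ℝ] ℝ) :=
  (k * ε / 2) • matB (ε • S.η x) (fun i => c.e i x) (fun i => c.Je i x)
    + ((k * ε * δ / 2) • matC (ε • S.η x) (fun i => c.e i x) (fun i => c.Je i x)
    + (k * m * ε / 2) • formSmul (ε • S.η x) matI)

lemma twistedMatrix_eq (ε δ k m : ℝ) (A : TangentConnection K) (x : K) :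
    c.twistedMatrix ε δ k m A x = c.connMatrix ε A x + c.twist ε δ k m x := by
  simp only [twistedMatrix, squashedMatrix, twist, add_assoc]

lemma twist_apply (ε δ k m : ℝ) (x : K) (a b : Idx) (v : TangentSpace (𝓡 7) x) :
    c.twist ε δ k m x a b v
      = k * ε / 2 * bismutMatrix δ m (fun d => c.coframe ε d x v) a b := by
  rw [bismutMatrix_eq δ m (fun d => c.coframe ε d x) v a b]
  have h : c.twist ε δ k m x a b v
      = k * ε / 2 * matB (ε • S.η x) (fun i => c.e i x) (fun i => c.Je i x) a b v
      + (k * ε * δ / 2 * matC (ε • S.η x) (fun i => c.e i x) (fun i => c.Je i x) a b v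
      + k * m * ε / 2 * formSmul (ε • S.η x) matI a b v) := rfl
  rw [h]
  simp only [coframe]
  ring

/-- The twist with its indices lowered by `g_ε`. This expression does not involve the coframe. -/
lemma sum_twist (hx : x ∈ c.U) (δ k m : ℝ) (v w z : TangentSpace (𝓡 7) x) :
    ∑ a, (∑ b, c.twist ε δ k m x a b v * c.coframe ε b x w) * c.coframe ε a x z
      = k * ε / 2 * (-((ε • S.η x) z * S.kaehler x v w) + (ε • S.η x) w * S.kaehler x v z
          + (1 + m) * ((ε • S.η x) v * S.kaehler x w z))
        + k * δ / 2 * S.flux ε x v w z := by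
  have h := sum_bismutMatrix δ m (fun a => c.coframe ε a x v) (fun a => c.coframe ε a x w)
    (fun a => c.coframe ε a x z) (fun v w => ∑ i, (v (.inr (.inl i)) * w (.inr (.inr i))
      - v (.inr (.inr i)) * w (.inr (.inl i)))) (fun _ _ => rfl)
  have hω : ∀ v w : TangentSpace (𝓡 7) x, ∑ i, (c.coframe ε (.inr (.inl i)) x v
      * c.coframe ε (.inr (.inr i)) x w - c.coframe ε (.inr (.inr i)) x v
      * c.coframe ε (.inr (.inl i)) x w) = S.kaehler x v w := fun v w => by
    rw [c.ω_eq x hx]; rfl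
  simp only [hω] at h
  have hΩ : (Matrix.of fun i j : Fin 3 =>
      ((![fun a => c.coframe ε a x v, fun a => c.coframe ε a x w, fun a => c.coframe ε a x z] j
        (.inr (.inl i)) : ℂ) + Complex.I * (![fun a => c.coframe ε a x v,
          fun a => c.coframe ε a x w, fun a => c.coframe ε a x z] j (.inr (.inr i)) : ℂ))).det
      = S.Ω x ![v, w, z] := by
    rw [c.Ω_eq x hx]
    congr 1
    ext i j
    fin_cases j <;> rfl
  rw [hΩ] at h
  have h2 : ∑ a, (∑ b, c.twist ε δ k m x a b v * c.coframe ε b x w) * c.coframe ε a x z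
      = k * ε / 2 * ∑ a, (∑ b, bismutMatrix δ m (fun a => c.coframe ε a x v) a b
        * c.coframe ε b x w) * c.coframe ε a x z := by
    simp only [c.twist_apply, Finset.mul_sum, Finset.sum_mul]
    exact Finset.sum_congr rfl fun a _ => Finset.sum_congr rfl fun b _ => by ring
  rw [h2, h]
  have h0 : ∀ v, c.coframe ε (.inl ()) x v = ε * S.η x v := fun v => rfl
  simp only [h0, flux, wedgeKaehler, _root_.smul_apply, smul_eq_mul]
  ring

lemma connMatrix_of_isTwistedConnection {δ k m : ℝ} {θ : TangentConnection K}
    (hθ : S.IsTwistedConnection ε δ k m A θ) (hx : x ∈ c.U) (a b : Idx)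
    (v : TangentSpace (𝓡 7) x) :
    c.connMatrix ε θ x a b v = c.connMatrix ε A x a b v
      + k * ε / 2 * bismutMatrix δ m (fun d => c.coframe ε d x v) a b := by
  rw [hθ c x hx, c.twistedMatrix_eq, ← c.twist_apply]
  rfl

/-- The torsion of the twisted connection, with its index lowered by `g_ε`. -/
theorem g_torsion (hA : S.IsTransverseLeviCivita A) (hx : x ∈ c.U) (hε : ε ≠ 0) {δ k m : ℝ}
    {θ : TangentConnection K} (hθ : S.IsTwistedConnection ε δ k m A θ)
    (X Y Z : TangentSpace (𝓡 7) x) :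
    S.g ε x (θ.torsion x X Y) Z
      = (1 - k - k * m / 2) * ε * (S.kaehler x X Y * (ε • S.η x) Z)
        + k * m * ε / 2 * S.wedgeKaehler x (ε • S.η x) X Y Z
        + k * δ * S.flux ε x X Y Z := by
  -- the torsions of `θ` and `A` differ by the antisymmetrization of the twist
  have h1 : ∀ a, c.coframe ε a x (θ.torsion x X Y) = S.kaehler x X Y * c.coframe ε a x (S.ξ x)
      + (∑ b, c.twist ε δ k m x a b X * c.coframe ε b x Y
        - ∑ b, c.twist ε δ k m x a b Y * c.coframe ε b x X) := by
    intro a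
    obtain ⟨X', hX', rfl⟩ := exists_diffFieldAt X
    obtain ⟨Y', hY', rfl⟩ := exists_diffFieldAt Y
    have hA' := c.coframe_torsion hx hε A hX' hY' a
    rw [c.torsion_transverseLeviCivita hA hx, map_smul, smul_eq_mul] at hA'
    rw [c.coframe_torsion hx hε θ hX' hY' a, hA', hθ c x hx, c.twistedMatrix_eq,
      ← Finset.sum_sub_distrib, add_assoc, ← Finset.sum_add_distrib]
    congr 1
    refine Finset.sum_congr rfl fun b _ => ?_
    simp only [Matrix.add_apply, _root_.add_apply]
    ring
  -- this is `g_ε(ξ, Z)`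
  have h2 : ∑ a, c.coframe ε a x (S.ξ x) * c.coframe ε a x Z = ε ^ 2 * S.η x Z := by
    rw [← c.g_eq hx, g, gV, S.kaehler_swap, S.η_ξ]
    rw [show S.kaehler x (S.J x Z) (S.ξ x) = 0 by
      rw [S.kaehler_swap, neg_eq_zero]; exact S.reeb x _]
    ring
  have h3 := c.sum_twist hx (ε := ε) δ k m X Y Z
  have h4 := c.sum_twist hx (ε := ε) δ k m Y X Z
  rw [c.g_eq hx]
  simp only [h1, add_mul, sub_mul, Finset.sum_add_distrib, Finset.sum_sub_distrib]
  rw [h3, h4, S.flux_swap, S.kaehler_swap x Y X]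
  simp only [mul_assoc, ← Finset.mul_sum]
  rw [h2]
  simp only [wedgeKaehler, _root_.smul_apply, smul_eq_mul, S.kaehler_swap x Z X]
  ring

/-- The curvature of the twisted connection. The terms of first order in the twist combine, by
`SU(3)`-invariance, to the value of the twist on the torsion `ω ⊗ ξ` of `A`, and those of second
order to the commutator. -/
theorem curvMatrix_of_isTwistedConnection (hA : S.IsTransverseLeviCivita A) (hx : x ∈ c.U)
    (hε : ε ≠ 0) {δ k m : ℝ} {θ : TangentConnection K}
    (hθ : S.IsTwistedConnection ε δ k m A θ) {X Y : ∀ y : K, TangentSpace (𝓡 7) y}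
    (hX : DiffFieldAt X x) (hY : DiffFieldAt Y x) :
    c.curvMatrix ε θ X Y x
      = c.curvMatrix ε A X Y x
        + (k * ε ^ 2 * (1 - δ + m) / 2 * S.kaehler x (X x) (Y x)) • matI
        + (k ^ 2 * ε ^ 2 / 4) •
          (matQ δ m (ε • S.η x) (fun i => c.e i x) (fun i => c.Je i x)).map
            (fun q => q (X x) (Y x)) := by
  set N : TangentSpace (𝓡 7) x → Matrix Idx Idx ℝ :=
    fun v => bismutMatrix δ m (fun d => c.coframe ε d x v) with hN
  set Γ : TangentSpace (𝓡 7) x → Matrix Idx Idx ℝ :=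
    fun v => (c.connMatrix ε A x).map (fun θ => θ v) with hΓ
  -- the derivative of the connection matrix of `θ` along a field
  have hd : ∀ Z : ∀ y : K, TangentSpace (𝓡 7) y, DiffFieldAt Z x → ∀ a b,
      MDifferentiableAt (𝓡 7) 𝓘(ℝ, ℝ) (fun y => c.connMatrix ε θ y a b (Z y)) x ∧
      ∀ v, mvfderiv (𝓡 7) (fun y => c.connMatrix ε θ y a b (Z y)) x v
        = mvfderiv (𝓡 7) (fun y => c.connMatrix ε A y a b (Z y)) x v + k * ε / 2 *
          bismutMatrix δ m (fun d => mvfderiv (𝓡 7) (fun y => c.coframe ε d y (Z y)) x v) a b := by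
    intro Z hZ a b
    have e1 : (fun y => c.connMatrix ε θ y a b (Z y)) =ᶠ[𝓝 x] fun y =>
        c.connMatrix ε A y a b (Z y)
          + k * ε / 2 * bismutMatrix δ m (fun d => c.coframe ε d y (Z y)) a b := by
      filter_upwards [c.isOpen_U.mem_nhds hx] with y hy
      exact c.connMatrix_of_isTwistedConnection hθ hy a b (Z y)
    have e2 := c.mdifferentiableAt_connMatrix hA hx hε hZ a b
    obtain ⟨e3, e3'⟩ := mdifferentiableAt_bismutMatrix δ m
      (fun d => c.mdifferentiableAt_coframe (ε := ε) hx d hZ) a b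
    have e4 : MDifferentiableAt (𝓡 7) 𝓘(ℝ, ℝ)
        (fun y => k * ε / 2 * bismutMatrix δ m (fun d => c.coframe ε d y (Z y)) a b) x :=
      mdifferentiableAt_const.mul e3
    refine ⟨(e2.add e4).congr_of_eventuallyEq e1, fun v => ?_⟩
    have e5 : mvfderiv (𝓡 7) (fun y => c.connMatrix ε θ y a b (Z y)) x
        = mvfderiv (𝓡 7) (fun y => c.connMatrix ε A y a b (Z y)
          + k * ε / 2 * bismutMatrix δ m (fun d => c.coframe ε d y (Z y)) a b) x := by
      simp only [mvfderiv, e1.mfderiv_eq]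
      rw [e1.eq_of_nhds]
      rfl
    rw [e5, mvfderiv_fun_add e2 e4, _root_.add_apply,
      mvfderiv_fun_mul mdifferentiableAt_const e3, mvfderiv_const, ← e3']
    simp
  have hQ := bismutMatrix_commutator δ (X x) (Y x) m (fun a => c.coframe ε a x)
  have hinv : ∀ v w, Γ v * N w - N w * Γ v
      = bismutMatrix δ m ((Γ v).mulVec fun d => c.coframe ε d x w) := by
    intro v w
    refine commutator_bismutMatrix δ m (Γ v) _ ?_ ?_ ?_ ?_ ?_ ?_
    · intro u b
      simp [hΓ, c.connMatrix_inl_left hA hx]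
    · intro a u
      simp [hΓ, c.connMatrix_inl_right hA]
    · rintro (u | a) (t | b)
      · simp [hΓ, c.connMatrix_inl_left hA hx]
      · simp [hΓ, c.connMatrix_inl_left hA hx, c.connMatrix_inl_right hA]
      · simp [hΓ, c.connMatrix_inl_left hA hx, c.connMatrix_inl_right hA]
      · exact c.connMatrix_skew hA hx hε a b v
    · intro i j
      have h := c.connMatrix_J hA hx hε (.inl i) (.inr j) v
      simp only [sgn, Sum.elim_inl, Sum.elim_inr, Sum.swap_inl, Sum.swap_inr] at h
      simp only [hΓ, Matrix.map_apply]
      linarith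
    · intro i j
      have h := c.connMatrix_J hA hx hε (.inl i) (.inl j) v
      simp only [sgn, Sum.elim_inl, Sum.swap_inl] at h
      simp only [hΓ, Matrix.map_apply]
      linarith
    · exact c.sum_connMatrix hA hx hε v
  have hξ : N (S.ξ x) = ((1 - δ + m) * ε) • matI := by
    rw [← bismutMatrix_inl]
    refine congrArg (bismutMatrix δ m) (funext fun a => ?_)
    rcases a with u | a
    · simp [coframe, S.η_ξ]
    · exact c.coframe_ξ hx a
  -- the terms of first order in `k`, by invariance and the structure equation
  have hstr : bismutMatrix δ m (fun d => mvfderiv (𝓡 7) (fun y => c.coframe ε d y (Y y)) x (X x))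
      - bismutMatrix δ m (fun d => mvfderiv (𝓡 7) (fun y => c.coframe ε d y (X y)) x (Y x))
      - N (VectorField.mlieBracket (𝓡 7) X Y x)
      + (Γ (X x) * N (Y x) - N (Y x) * Γ (X x)) - (Γ (Y x) * N (X x) - N (X x) * Γ (Y x))
      = (S.kaehler x (X x) (Y x) * ((1 - δ + m) * ε)) • matI := by
    rw [hinv, hinv, mul_smul, ← hξ, hN]
    simp only [← bismutMatrixₗ_apply, ← map_sub, ← map_add, ← map_smul]
    congr 1
    funext a
    have h := c.structure_equation hA hx hε hX hY a
    simp only [Pi.sub_apply, Pi.add_apply, Pi.smul_apply, smul_eq_mul]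
    rw [h]
    ring
  ext a b
  have hs := congrFun (congrFun hstr a) b
  have hq := congrFun (congrFun hQ a) b
  simp only [Matrix.add_apply, Matrix.sub_apply, Matrix.smul_apply, smul_eq_mul] at hs hq ⊢
  have hq' : (matQ δ m (ε • S.η x) (fun i => c.e i x) (fun i => c.Je i x)).map
      (fun q => q (X x) (Y x)) a b = (N (X x) * N (Y x)) a b - (N (Y x) * N (X x)) a b := hq.symm
  rw [hq', c.curvMatrix_apply hx hε θ (fun a b => (hd X hX a b).1) (fun a b => (hd Y hY a b).1),
    c.curvMatrix_apply hx hε A (c.mdifferentiableAt_connMatrix hA hx hε hX)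
      (c.mdifferentiableAt_connMatrix hA hx hε hY), (hd X hX a b).2, (hd Y hY a b).2]
  have hθ' : ∀ a b v, c.connMatrix ε θ x a b v = Γ v a b + k * ε / 2 * N v a b :=
    c.connMatrix_of_isTwistedConnection hθ hx
  have hA' : ∀ a b v, c.connMatrix ε A x a b v = Γ v a b := fun _ _ _ => rfl
  have hsum : ∑ d, ((Γ (X x) a d + k * ε / 2 * N (X x) a d)
        * (Γ (Y x) d b + k * ε / 2 * N (Y x) d b)
      - (Γ (Y x) a d + k * ε / 2 * N (Y x) a d) * (Γ (X x) d b + k * ε / 2 * N (X x) d b))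
      = ∑ d, (Γ (X x) a d * Γ (Y x) d b - Γ (Y x) a d * Γ (X x) d b)
        + k * ε / 2 * ((Γ (X x) * N (Y x)) a b - (N (Y x) * Γ (X x)) a b
          - ((Γ (Y x) * N (X x)) a b - (N (X x) * Γ (Y x)) a b))
        + (k * ε / 2) ^ 2 * ((N (X x) * N (Y x)) a b - (N (Y x) * N (X x)) a b) := by
    simp only [Matrix.mul_apply, ← Finset.sum_sub_distrib, Finset.mul_sum,
      ← Finset.sum_add_distrib]
    exact Finset.sum_congr rfl fun d _ => by ring
  simp only [hθ', hA', hsum]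
  linear_combination (k * ε / 2) * hs

/-! ### Existence of the twisted connection -/

/-- The twist as a tensor: it sends a section `w` and a direction `v` to
`∑ (kε/2) (B + δ C + m e₀ 𝓘)_{ab}(v) e_b(w) E_a`. -/
def twistTensor (ε δ k m : ℝ) (x : K) :
    TangentSpace (𝓡 7) x →L[ℝ] TangentSpace (𝓡 7) x →L[ℝ] TangentSpace (𝓡 7) x :=
  ∑ a, ∑ b, (c.coframe ε b x).smulRight ((c.twist ε δ k m x a b).smulRight (c.frame ε a x))

lemma coframe_twistTensor (hx : x ∈ c.U) (hε : ε ≠ 0) (δ k m : ℝ) (v w : TangentSpace (𝓡 7) x)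
    (a : Idx) :
    c.coframe ε a x (c.twistTensor ε δ k m x w v)
      = ∑ b, c.twist ε δ k m x a b v * c.coframe ε b x w := by
  simp only [twistTensor, _root_.sum_apply, ContinuousLinearMap.smulRight_apply,
    _root_.smul_apply, map_sum, map_smul, smul_eq_mul, c.coframe_frame hx hε]
  rw [Finset.sum_eq_single a (fun b _ hb => by simp [hb.symm]) (by simp)]
  simp [mul_comm]

/-- The twist does not depend on the coframe, since its lowered form does not. -/
lemma twistTensor_eq (hε : ε ≠ 0) (δ k m : ℝ) (c' : S.Coframe) (hx : x ∈ c.U) (hx' : x ∈ c'.U) :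
    c.twistTensor ε δ k m x = c'.twistTensor ε δ k m x := by
  ext w v
  have h : ∀ z, S.g ε x (c.twistTensor ε δ k m x w v) z
      = S.g ε x (c'.twistTensor ε δ k m x w v) z := by
    intro z
    rw [c.g_eq hx, c'.g_eq hx']
    simp only [c.coframe_twistTensor hx hε, c'.coframe_twistTensor hx' hε]
    rw [c.sum_twist hx, c'.sum_twist hx']
  refine c.eq_of_coframe_eq hx hε fun a => ?_
  have h2 := h (c.frame ε a x)
  rw [c.g_eq hx, c.g_eq hx] at h2
  simpa [c.coframe_frame hx hε] using h2

end Coframe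

/-- The connection is `A` plus the twist tensor, which is taken from any coframe around the point.
At points covered by no basic coframe nothing is required, and the tensor is set to zero there. -/
theorem exists_isTwistedConnection (S : ContactCalabiYau K) (A : TangentConnection K) {ε : ℝ}
    (hε : ε ≠ 0) (δ k m : ℝ) : ∃ θ : TangentConnection K, S.IsTwistedConnection ε δ k m A θ := by
  classical
  let a : ∀ x : K, TangentSpace (𝓡 7) x →L[ℝ] TangentSpace (𝓡 7) x →L[ℝ] TangentSpace (𝓡 7) x :=
    fun x => if h : ∃ c : S.Coframe, x ∈ c.U then h.choose.twistTensor ε δ k m x else 0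
  refine ⟨A.addOneForm a, fun c x hx => ?_⟩
  have ha : a x = c.twistTensor ε δ k m x := by
    have h : ∃ c : S.Coframe, x ∈ c.U := ⟨c, hx⟩
    rw [show a x = h.choose.twistTensor ε δ k m x from dif_pos h]
    exact h.choose.twistTensor_eq hε δ k m c h.choose_spec hx
  rw [c.twistedMatrix_eq]
  ext i j v
  have h1 : c.connMatrix ε (A.addOneForm a) x i j v = c.connMatrix ε A x i j v
      + c.coframe ε i x (a x (c.frame ε j x) v) := map_add (c.coframe ε i x) _ _
  rw [h1, ha, c.coframe_twistTensor hx hε]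
  simp [c.coframe_frame hx hε]

end ContactCalabiYau

end Torsion

end

theorem mainTheorem4 {K : Type*} [TopologicalSpace K] [T2Space K] [ChartedSpace E7 K]
    [IsManifold (𝓡 7) ∞ K]
    (S : ContactCalabiYau K) (A : TangentConnection K) (hA : S.IsTransverseLeviCivita A)
    (ε δ k m : ℝ) (hε : 0 < ε) (hk : k ≠ 0) :
    (∃ θ : TangentConnection K, S.IsTwistedConnection ε δ k m A θ) ∧
    ∀ θ : TangentConnection K, S.IsTwistedConnection ε δ k m A θ →
      ∀ c : S.Coframe, ∀ x ∈ c.U,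
        (∀ X Y Z : TangentSpace (𝓡 7) x,
          S.g ε x (θ.torsion x X Y) Z
            = (1 - k - k * m / 2) * ε * (S.kaehler x X Y * (ε • S.η x) Z)
              + k * m * ε / 2 * S.wedgeKaehler x (ε • S.η x) X Y Z
              + k * δ * S.flux ε x X Y Z) ∧
        ∀ X Y : ∀ y : K, TangentSpace (𝓡 7) y, SmoothFieldAt X x → SmoothFieldAt Y x →
          c.curvMatrix ε θ X Y x
            = c.curvMatrix ε A X Y x
              + (k * ε ^ 2 * (1 - δ + m) / 2 * S.kaehler x (X x) (Y x)) • matI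
              + (k ^ 2 * ε ^ 2 / 4) •
                (matQ δ m (ε • S.η x) (fun i => c.e i x) (fun i => c.Je i x)).map
                  (fun q => q (X x) (Y x)) :=
  ⟨S.exists_isTwistedConnection A hε.ne' δ k m, fun _ hθ c _ hx =>
    ⟨c.g_torsion hA hx hε.ne' hθ, fun _ _ hX hY =>
      c.curvMatrix_of_isTwistedConnection hA hx hε.ne' hθ hX.diffFieldAt hY.diffFieldAt⟩⟩
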